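/- Let $\mathcal H=\bigoplus_{n\ge 0}\mathcal H_n$ be a connected graded commutative Hopf algebra over $\mathbb C$ and let $\mathcal A=\mathbb C((\lambda))$ be the algebra of formal Laurent series, with $\mathcal A_+=\mathbb C[[\lambda]]$, $\mathcal A_-=\lambda^{-1}\mathbb C[\lambda^{-1}]$ and projections $P_\pm:\mathcal A\to\mathcal A_\pm$. Let $G_{\mathcal A}$ be the group of characters (unital algebra homomorphisms $\mathcal H\to\mathcal A$) under convolution $\star$, with unit the counit $\varepsilon$. Let $\mathfrak g_{\mathcal A}$ be the Lie algebra of infinitesimal characters, i.e. linear maps $Z:\mathcal H\to\mathcal A$ with $Z(xy)=Z(x)\varepsilon(y)+\varepsilon(x)Z(y)$, with bracket $[Z,Z']=Z\star Z'-Z'\star Z$, and put $\mathrm{Ad}(g)L=g\star L\star g^{-1}$. The Birkhoff decomposition of $\varphi\in G_{\mathcal A}$ is $\varphi=\varphi_-^{-1}\star\varphi_+$ with $\varphi_\pm\in G_{\mathcal A}$, $\varphi_-(\ker\varepsilon)\subset\mathcal A_-$ and $\varphi_+(\mathcal H)\subset\mathcal A_+$. For $t\in\mathbb C$ let $\varphi^t(x)=e^{tn\lambda}\varphi(x)$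 for $x\in\mathcal H_n$; the character $\varphi$ is local if $(\varphi^t)_-$ does not depend on $t$. Let $Y(x)=nx$ for $x\in\mathcal H_n$ and $\tilde R(\varphi)=\varphi^{-1}\star(\varphi\circ Y)$. Let $f:\mathfrak g_{\mathcal A}\to\mathfrak g_{\mathcal A}$ be any $\mathrm{Ad}$-covariant map, i.e. $\mathrm{Ad}(g)f(L)=f(\mathrm{Ad}(g)L)$ for all $g\in G_{\mathcal A}$ and $L\in\mathfrak g_{\mathcal A}$, and let $\varphi$ be a local character. Consider the Lax equation $$\frac{dL}{dt}=[L,M],\qquad M=\tfrac12 (P_+-P_-)\circ f(L),\qquad t\in\mathbb R,\qquad(*)$$ where derivatives are taken in each Laurent coefficient of each value $L(t)(x)$, $x\in\mathcal H$. (a) The map $\tilde R:G_{\mathcal A}\to\mathfrak g_{\mathcal A}$ is bijective. With $L_0=\tilde R(\varphi)$, equation $(*)$ has a solution $L:\mathbb R\to\mathfrak g_{\mathcal A}$ with $L(0)=L_0$ given by $L(t)=\mathrm{Ad}(g_\pm(t))L_0$ (the same for both signs), where $\exp(-tf(L_0))=g_-(t)^{-1}\star g_+(t)$ is the Birkhoff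 decomposition. For every solution $L:\mathbb R\to\mathfrak g_{\mathcal A}$ of $(*)$ with $L(0)=L_0$, the character $\varphi_t=\tilde R^{-1}(L(t))$ is local for all $t$. (b) The same statements hold with $\lambda\tilde R$ in place of $\tilde R$ throughout: $\lambda\tilde R$ is bijective; with $L_0=\lambda\tilde R(\varphi)$ the formula above gives a solution of $(*)$; and for every solution $L:\mathbb R\to\mathfrak g_{\mathcal A}$ with $L(0)=L_0$ the character $\tau_t=(\lambda\tilde R)^{-1}(L(t))$ is local for all $t$. -/

import Mathlib

open scoped TensorProduct

noncomputable section

namespace HopfLax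

/-- The algebra `𝓐` of formal Laurent series in `λ` with complex coefficients, as a type of its own
so that its only `ℂ`-module structure is the one of the algebra structure. -/
def Laurent : Type := LaurentSeries ℂ

instance : CommRing Laurent := inferInstanceAs (CommRing (LaurentSeries ℂ))

instance : Algebra ℂ Laurent := (HahnSeries.instAlgebra : Algebra ℂ (HahnSeries ℤ ℂ))

/-- The identity map from `𝓐` to Mathlib's Laurent series. -/
def Laurent.equiv : Laurent ≃+* LaurentSeries ℂ := RingEquiv.refl (LaurentSeries ℂ)

/-- The coefficient of `λⁿ`. -/
def Laurent.coeff (a : Laurent) (n : ℤ) : ℂ := (Laurent.equiv a).coeff n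

theorem Laurent.ext {a b : Laurent} (h : ∀ n : ℤ, a.coeff n = b.coeff n) : a = b :=
  Laurent.equiv.injective (HahnSeries.ext (funext h))

theorem Laurent.coeff_smul (c : ℂ) (n : ℤ) (a : Laurent) : (c • a).coeff n = c * a.coeff n := by
  unfold Laurent.coeff
  have h : Laurent.equiv (algebraMap ℂ Laurent c) = HahnSeries.C c := rfl
  rw [Algebra.smul_def, map_mul, h, HahnSeries.C_mul_eq_smul, HahnSeries.coeff_smul, smul_eq_mul]

/-- The Laurent series `λ`. -/
def lam : Laurent := Laurent.equiv.symm (HahnSeries.single (1 : ℤ) (1 : ℂ))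

/-- A power series in `λ`, as a Laurent series. -/
def ofPowerSeries : PowerSeries ℂ →+* Laurent :=
  (Laurent.equiv.symm : LaurentSeries ℂ →+* Laurent).comp (HahnSeries.ofPowerSeries ℤ ℂ)

/-- The Laurent series `e^{cλ}`. -/
def expLam (c : ℂ) : Laurent := ofPowerSeries (PowerSeries.rescale c (PowerSeries.exp ℂ))

theorem expLam_zero : expLam 0 = 1 := by
  simp [expLam]

theorem expLam_add (a b : ℂ) : expLam (a + b) = expLam a * expLam b := by
  simp only [expLam, ← map_mul, PowerSeries.exp_mul_exp_eq_exp_add]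

/-- Holomorphic Laurent series: those without a pole part. -/
def IsHolomorphic (a : Laurent) : Prop := ∀ n : ℤ, n < 0 → a.coeff n = 0

/-- Polynomials in `λ⁻¹` without constant term. -/
def IsPolar (a : Laurent) : Prop := ∀ n : ℤ, 0 ≤ n → a.coeff n = 0

theorem coeff_truncLT (a : Laurent) (n : ℤ) :
    (Laurent.equiv.symm (HahnSeries.truncLT (0 : ℤ) (Laurent.equiv a))).coeff n =
      if n < 0 then a.coeff n else 0 := by
  unfold Laurent.coeff
  rw [RingEquiv.apply_symm_apply]
  split_ifs with h
  · exact HahnSeries.coeff_truncLT_of_lt h _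
  · exact HahnSeries.coeff_truncLT_of_le (not_lt.mp h) _

/-- The projection `P₋` of a Laurent series to its pole part. -/
def polePart : Laurent →ₗ[ℂ] Laurent where
  toFun a := Laurent.equiv.symm (HahnSeries.truncLT (0 : ℤ) (Laurent.equiv a))
  map_add' a b := by
    rw [map_add, HahnSeries.truncLT_add, map_add]
  map_smul' c a := by
    refine Laurent.ext fun n => ?_
    rw [RingHom.id_apply, coeff_truncLT, Laurent.coeff_smul, Laurent.coeff_smul, coeff_truncLT]
    split_ifs <;> simp

theorem polePart_coeff (a : Laurent) (n : ℤ) :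
    (polePart a).coeff n = if n < 0 then a.coeff n else 0 :=
  coeff_truncLT a n

/-- The projection `P₊` of a Laurent series to its holomorphic part. -/
def holPart : Laurent →ₗ[ℂ] Laurent := LinearMap.id - polePart

variable {H : Type*} [CommRing H] [HopfAlgebra ℂ H]

/-- The grading `𝒜` makes the commutative Hopf algebra `H` a connected graded Hopf algebra. (That
the product is graded is the class `GradedAlgebra 𝒜`; that the antipode is graded is automatic.) -/
structure IsConnectedGradedHopf (𝒜 : ℕ → Submodule ℂ H) : Prop where
  comul_mem : ∀ n : ℕ, ∀ x ∈ 𝒜 n, CoalgebraStruct.comul (R := ℂ) x ∈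
    ⨆ p ∈ Finset.HasAntidiagonal.antidiagonal n,
      LinearMap.range (TensorProduct.map (𝒜 p.1).subtype (𝒜 p.2).subtype)
  counit_eq_zero : ∀ n : ℕ, n ≠ 0 → ∀ x ∈ 𝒜 n, CoalgebraStruct.counit (R := ℂ) x = 0
  connected : ∀ x ∈ 𝒜 0, ∃ c : ℂ, x = algebraMap ℂ H c

variable (H) in
/-- The convolution algebra of linear maps `H → 𝓐`; its product is `⋆`, its unit is `ε`. -/
abbrev ConvAlg : Type _ := WithConv (H →ₗ[ℂ] Laurent)

variable (H) in
/-- The group `G_𝓐` of Laurent series valued characters, with the convolution product. -/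
abbrev CharGroup : Type _ := WithConv (H →ₐ[ℂ] Laurent)

instance : Inv (CharGroup H) where
  inv φ := WithConv.toConv (φ.ofConv.comp (HopfAlgebra.antipodeAlgHom ℂ H))

instance : Group (CharGroup H) where
  inv_mul_cancel φ := by
    refine WithConv.ext (AlgHom.ext fun x => ?_)
    have h := ((Coalgebra.Repr.arbitrary ℂ x).convMul_apply
      (WithConv.toConv (φ⁻¹).ofConv.toLinearMap : ConvAlg H)
      (WithConv.toConv φ.ofConv.toLinearMap))
    refine h.trans ?_
    change ∑ i ∈ (Coalgebra.Repr.arbitrary ℂ x).index,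
      φ.ofConv (HopfAlgebra.antipode ℂ ((Coalgebra.Repr.arbitrary ℂ x).left i)) *
        φ.ofConv ((Coalgebra.Repr.arbitrary ℂ x).right i) =
      algebraMap ℂ Laurent (CoalgebraStruct.counit (R := ℂ) x)
    simp only [← map_mul]
    rw [← map_sum, HopfAlgebra.sum_antipode_mul_eq_algebraMap_counit, AlgHom.commutes]

/-- A character, seen as an element of the convolution algebra. -/
def CharGroup.toConvAlg (φ : CharGroup H) : ConvAlg H := WithConv.toConv φ.ofConv.toLinearMap

theorem CharGroup.toConvAlg_apply (φ : CharGroup H) (x : H) : φ.toConvAlg x = φ x := rfl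

theorem CharGroup.toConvAlg_mul (φ ψ : CharGroup H) :
    (φ * ψ).toConvAlg = φ.toConvAlg * ψ.toConvAlg := rfl

theorem CharGroup.toConvAlg_one : (1 : CharGroup H).toConvAlg = 1 := rfl

/-- `D` is a derivation along `g`. -/
def IsDerAlong (g D : ConvAlg H) : Prop := ∀ x y : H, D (x * y) = D x * g y + g x * D y

theorem conv_apply_mul (f g : ConvAlg H) (x y : H) :
    (f * g) (x * y) = ∑ i ∈ (Coalgebra.Repr.arbitrary ℂ x).index,
      ∑ j ∈ (Coalgebra.Repr.arbitrary ℂ y).index,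
        f ((Coalgebra.Repr.arbitrary ℂ x).left i * (Coalgebra.Repr.arbitrary ℂ y).left j) *
        g ((Coalgebra.Repr.arbitrary ℂ x).right i * (Coalgebra.Repr.arbitrary ℂ y).right j) := by
  rw [((Coalgebra.Repr.arbitrary ℂ x).mul (Coalgebra.Repr.arbitrary ℂ y)).convMul_apply]
  simp [Finset.sum_product]

theorem conv_apply_mul_conv_apply (f g f' g' : ConvAlg H) (x y : H) :
    (f * g) x * (f' * g') y = ∑ i ∈ (Coalgebra.Repr.arbitrary ℂ x).index,
      ∑ j ∈ (Coalgebra.Repr.arbitrary ℂ y).index,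
        (f ((Coalgebra.Repr.arbitrary ℂ x).left i) * g ((Coalgebra.Repr.arbitrary ℂ x).right i)) *
        (f' ((Coalgebra.Repr.arbitrary ℂ y).left j) *
          g' ((Coalgebra.Repr.arbitrary ℂ y).right j)) := by
  rw [(Coalgebra.Repr.arbitrary ℂ x).convMul_apply, (Coalgebra.Repr.arbitrary ℂ y).convMul_apply,
    Finset.sum_mul_sum]

theorem IsDerAlong.mul_char {g D : ConvAlg H} (hD : IsDerAlong g D) (h : CharGroup H) :
    IsDerAlong (g * h.toConvAlg) (D * h.toConvAlg) := by
  intro x y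
  rw [conv_apply_mul, conv_apply_mul_conv_apply, conv_apply_mul_conv_apply,
    ← Finset.sum_add_distrib]
  refine Finset.sum_congr rfl fun i _ => ?_
  rw [← Finset.sum_add_distrib]
  refine Finset.sum_congr rfl fun j _ => ?_
  rw [hD]
  simp only [CharGroup.toConvAlg_apply, map_mul]
  ring

theorem IsDerAlong.char_mul {g D : ConvAlg H} (hD : IsDerAlong g D) (h : CharGroup H) :
    IsDerAlong (h.toConvAlg * g) (h.toConvAlg * D) := by
  intro x y
  rw [conv_apply_mul, conv_apply_mul_conv_apply, conv_apply_mul_conv_apply,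
    ← Finset.sum_add_distrib]
  refine Finset.sum_congr rfl fun i _ => ?_
  rw [← Finset.sum_add_distrib]
  refine Finset.sum_congr rfl fun j _ => ?_
  rw [hD]
  simp only [CharGroup.toConvAlg_apply, map_mul]
  ring

theorem IsDerAlong.lie {Z Z' : ConvAlg H} (hZ : IsDerAlong 1 Z) (hZ' : IsDerAlong 1 Z') :
    IsDerAlong 1 (Z * Z' - Z' * Z) := by
  have key : ∀ {Z Z' : ConvAlg H}, IsDerAlong 1 Z → IsDerAlong 1 Z' → ∀ x y : H,
      (Z * Z') (x * y) = (Z * Z') x * (1 : ConvAlg H) y + (1 : ConvAlg H) x * (Z * Z') y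
        + Z x * Z' y + Z' x * Z y := by
    intro Z Z' hZ hZ' x y
    have e1 : (Z * Z') x * (1 : ConvAlg H) y = (Z * Z') x * ((1 : ConvAlg H) * 1) y := by
      rw [mul_one]
    have e2 : (1 : ConvAlg H) x * (Z * Z') y = ((1 : ConvAlg H) * 1) x * (Z * Z') y := by
      rw [mul_one]
    have e3 : Z x * Z' y = (Z * 1) x * (1 * Z') y := by rw [mul_one, one_mul]
    have e4 : Z' x * Z y = (1 * Z') x * (Z * 1) y := by rw [mul_one, one_mul]
    rw [e1, e2, e3, e4, conv_apply_mul]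
    simp only [conv_apply_mul_conv_apply, ← Finset.sum_add_distrib]
    refine Finset.sum_congr rfl fun i _ => Finset.sum_congr rfl fun j _ => ?_
    rw [hZ, hZ']
    ring
  intro x y
  have e : ∀ z : H, (Z * Z' - Z' * Z) z = (Z * Z') z - (Z' * Z) z := fun _ => rfl
  rw [e, e, e, key hZ hZ', key hZ' hZ]
  ring

variable (H) in
/-- The Lie algebra `𝔤_𝓐` of Laurent series valued infinitesimal characters,
`Z(xy) = Z(x)ε(y) + ε(x)Z(y)`. -/
def infChar : Submodule ℂ (ConvAlg H) where
  carrier := {Z | ∀ x y : H, Z (x * y) =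
    Z x * algebraMap ℂ Laurent (CoalgebraStruct.counit (R := ℂ) y) +
      algebraMap ℂ Laurent (CoalgebraStruct.counit (R := ℂ) x) * Z y}
  add_mem' := by
    intro Z Z' hZ hZ' x y
    change Z (x * y) + Z' (x * y) = (Z x + Z' x) * _ + _ * (Z y + Z' y)
    rw [hZ, hZ']
    ring
  zero_mem' := by
    intro x y
    change (0 : Laurent) = 0 * _ + _ * 0
    simp
  smul_mem' := by
    intro c Z hZ x y
    change c • Z (x * y) = (c • Z x) * _ + _ * (c • Z y)
    rw [hZ, smul_add, smul_mul_assoc, mul_smul_comm]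

/-- The Lie bracket `[Z, Z'] = Z ⋆ Z' - Z' ⋆ Z` of `𝔤_𝓐`. -/
def bracket (Z Z' : infChar H) : infChar H :=
  ⟨(Z : ConvAlg H) * Z' - (Z' : ConvAlg H) * Z, IsDerAlong.lie Z.2 Z'.2⟩

/-- The adjoint action `Ad(g) L = g ⋆ L ⋆ g⁻¹` of `G_𝓐` on `𝔤_𝓐`. -/
def Ad (g : CharGroup H) (L : infChar H) : infChar H :=
  ⟨g.toConvAlg * (L : ConvAlg H) * (g⁻¹).toConvAlg, by
    have h := IsDerAlong.mul_char (IsDerAlong.char_mul (g := 1) (D := (L : ConvAlg H)) L.2 g) g⁻¹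
    rw [mul_one, ← CharGroup.toConvAlg_mul, mul_inv_cancel, CharGroup.toConvAlg_one] at h
    exact h⟩

/-- `f : 𝔤_𝓐 → 𝔤_𝓐` is `Ad`-covariant. -/
def IsAdCovariant (f : infChar H → infChar H) : Prop :=
  ∀ (g : CharGroup H) (L : infChar H), Ad g (f L) = f (Ad g L)

/-- `R = P₊ - P₋`, applied to the values of an infinitesimal character. -/
def projDiff (Z : infChar H) : infChar H :=
  ⟨WithConv.toConv ((holPart - polePart) ∘ₗ (Z : ConvAlg H).ofConv), by
    intro x y
    change (holPart - polePart) ((Z : ConvAlg H) (x * y)) =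
      (holPart - polePart) ((Z : ConvAlg H) x) * _ + _ * (holPart - polePart) ((Z : ConvAlg H) y)
    rw [Z.2 x y, mul_comm _ (algebraMap ℂ Laurent _), mul_comm _ (algebraMap ℂ Laurent _),
      ← Algebra.smul_def, ← Algebra.smul_def, ← Algebra.smul_def, ← Algebra.smul_def, map_add,
      map_smul, map_smul]⟩

/-- Multiplication of an infinitesimal character by `λ`. -/
def lamMul (Z : infChar H) : infChar H :=
  ⟨WithConv.toConv (LinearMap.mulLeft ℂ lam ∘ₗ (Z : ConvAlg H).ofConv), by
    intro x y
    change lam * (Z : ConvAlg H) (x * y) =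
      (lam * (Z : ConvAlg H) x) * _ + _ * (lam * (Z : ConvAlg H) y)
    rw [Z.2 x y]
    ring⟩

/-- `g = exp(Z) = ∑ₖ Z^{⋆k} / k!`; on each element of `H` the sum is finite. -/
def IsExp (Z : infChar H) (g : CharGroup H) : Prop :=
  ∀ x : H, ∀ᶠ N : ℕ in Filter.atTop,
    g x = ∑ k ∈ Finset.range N, ((k.factorial : ℂ)⁻¹) • (((Z : ConvAlg H) ^ k) x)

/-- `φ = φ₋⁻¹ ⋆ φ₊` is the Birkhoff decomposition of the character `φ`: `φ₊` is holomorphic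
and `φ₋` sends the augmentation ideal to polynomials in `λ⁻¹` without constant term. -/
structure IsBirkhoff (φ φm φp : CharGroup H) : Prop where
  eq : φ = φm⁻¹ * φp
  polar : ∀ x : H, CoalgebraStruct.counit (R := ℂ) x = 0 → IsPolar (φm x)
  holomorphic : ∀ x : H, IsHolomorphic (φp x)

section Graded

variable (𝒜 : ℕ → Submodule ℂ H) [GradedAlgebra 𝒜]

/-- The grading operator `Y`: `Y x = n x` for `x ∈ 𝒜 n`. -/
def gradingOp : H →ₗ[ℂ] H :=
  DirectSum.toModule ℂ ℕ H (fun n => (n : ℂ) • (𝒜 n).subtype) ∘ₗ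
    (DirectSum.decomposeLinearEquiv 𝒜).toLinearMap

theorem gradingOp_apply {n : ℕ} {x : H} (hx : x ∈ 𝒜 n) : gradingOp 𝒜 x = (n : ℂ) • x := by
  have h : DirectSum.decomposeLinearEquiv 𝒜 x = DirectSum.lof ℂ ℕ (fun i => 𝒜 i) n ⟨x, hx⟩ :=
    DirectSum.decomposeLinearEquiv_apply_coe 𝒜 n ⟨x, hx⟩
  simp only [gradingOp, LinearMap.comp_apply, LinearEquiv.coe_coe]
  rw [h, DirectSum.toModule_lof]
  rfl

theorem gradingOp_mul (x y : H) : gradingOp 𝒜 (x * y) = gradingOp 𝒜 x * y + x * gradingOp 𝒜 y := by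
  induction x using DirectSum.Decomposition.inductionOn 𝒜 with
  | zero => simp
  | add a b ha hb => simp only [add_mul, map_add, ha, hb]; ring
  | @homogeneous i a =>
    induction y using DirectSum.Decomposition.inductionOn 𝒜 with
    | zero => simp
    | add a b ha hb => simp only [mul_add, map_add, ha, hb]; ring
    | @homogeneous j b =>
      rw [gradingOp_apply 𝒜 (SetLike.mul_mem_graded a.2 b.2), gradingOp_apply 𝒜 a.2, gradingOp_apply 𝒜 b.2]
      simp only [Nat.cast_add, add_smul, smul_mul_assoc, mul_smul_comm]

/-- `R̃(φ) = φ⁻¹ ⋆ (φ ∘ Y)`. -/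
def Rtilde (φ : CharGroup H) : infChar H :=
  ⟨(φ⁻¹).toConvAlg * WithConv.toConv (φ.ofConv.toLinearMap ∘ₗ gradingOp 𝒜), by
    have h0 : IsDerAlong φ.toConvAlg
        (WithConv.toConv (φ.ofConv.toLinearMap ∘ₗ gradingOp 𝒜) : ConvAlg H) := by
      intro x y
      change φ.ofConv (gradingOp 𝒜 (x * y)) = φ.ofConv (gradingOp 𝒜 x) * φ.ofConv y + φ.ofConv x * φ.ofConv (gradingOp 𝒜 y)
      rw [gradingOp_mul, map_add, map_mul, map_mul]
    have h := h0.char_mul φ⁻¹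
    rw [← CharGroup.toConvAlg_mul, inv_mul_cancel, CharGroup.toConvAlg_one] at h
    exact h⟩

/-- `λR̃ : G_𝓐 → 𝔤_𝓐`. -/
def lamRtilde (φ : CharGroup H) : infChar H := lamMul (Rtilde 𝒜 φ)

/-- The map `x ↦ e^{tnλ} φ(x)` on `𝒜 n`. -/
def scaleHom (t : ℂ) (φ : CharGroup H) (n : ℕ) : 𝒜 n →ₗ[ℂ] Laurent :=
  LinearMap.mulLeft ℂ (expLam (t * n)) ∘ₗ φ.ofConv.toLinearMap ∘ₗ (𝒜 n).subtype

theorem scaleHom_one (t : ℂ) (φ : CharGroup H) :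
    scaleHom 𝒜 t φ 0 (GradedMonoid.GOne.one (A := fun i => 𝒜 i)) = 1 := by
  change expLam (t * ((0 : ℕ) : ℂ)) * φ.ofConv 1 = 1
  simp [expLam_zero]

theorem scaleHom_mul (t : ℂ) (φ : CharGroup H) {i j : ℕ} (a : 𝒜 i) (b : 𝒜 j) :
    scaleHom 𝒜 t φ (i + j) (GradedMonoid.GMul.mul (A := fun i => 𝒜 i) a b) =
      scaleHom 𝒜 t φ i a * scaleHom 𝒜 t φ j b := by
  change expLam (t * ((i + j : ℕ) : ℂ)) * φ.ofConv ((a : H) * (b : H)) =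
    (expLam (t * i) * φ.ofConv a) * (expLam (t * j) * φ.ofConv b)
  rw [Nat.cast_add, mul_add, expLam_add, map_mul]
  ring

/-- The character `φᵗ`, given by `φᵗ(x) = e^{tnλ} φ(x)` for `x ∈ 𝒜 n`. -/
def scale (t : ℂ) (φ : CharGroup H) : CharGroup H :=
  WithConv.toConv
    ((DirectSum.toAlgebra ℂ (fun i => 𝒜 i) (scaleHom 𝒜 t φ) (scaleHom_one 𝒜 t φ)
      (fun a b => scaleHom_mul 𝒜 t φ a b)).comp (DirectSum.decomposeAlgEquiv 𝒜).toAlgHom)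

theorem scale_apply (t : ℂ) (φ : CharGroup H) {n : ℕ} {x : H} (hx : x ∈ 𝒜 n) :
    scale 𝒜 t φ x = expLam (t * n) * φ x := by
  have h : DirectSum.decomposeAlgEquiv 𝒜 x = DirectSum.of (fun i => 𝒜 i) n ⟨x, hx⟩ :=
    DirectSum.decompose_of_mem 𝒜 hx
  simp only [scale]
  rw [AlgHom.comp_apply]
  refine (congrArg _ h).trans ?_
  exact DirectSum.toSemiring_of (fun i => (scaleHom 𝒜 t φ i).toAddMonoidHom)
    (scaleHom_one 𝒜 t φ) (fun a b => scaleHom_mul 𝒜 t φ a b) n ⟨x, hx⟩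

/-- Local characters: the negative part of the Birkhoff decomposition of `φᵗ` is independent
of `t`. -/
def IsLocal (φ : CharGroup H) : Prop :=
  ∃ φm : CharGroup H, ∀ t : ℂ, ∃ φp : CharGroup H, IsBirkhoff (scale 𝒜 t φ) φm φp

end Graded

/-- `L` solves `dL/dt = [L, M]`, `M = ½ R(f(L))`, with initial condition `L(0) = L₀`. Derivatives
are taken in each Laurent coefficient of each value. -/
structure IsLaxSolution (f : infChar H → infChar H) (L₀ : infChar H) (L : ℝ → infChar H) :
    Prop where
  init : L 0 = L₀
  deriv : ∀ (t : ℝ) (x : H) (n : ℤ),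
    HasDerivAt (fun s : ℝ => ((L s : ConvAlg H) x).coeff n)
      (((bracket (L t) ((1 / 2 : ℂ) • projDiff (f (L t))) : infChar H) : ConvAlg H) x |>.coeff n) t

/-- `L(t) = Ad(g₋(t)) L₀ = Ad(g₊(t)) L₀`, where `exp(-t f(L₀)) = g₋(t)⁻¹ ⋆ g₊(t)` is the
Birkhoff decomposition. -/
def IsFactorizationFlow (f : infChar H → infChar H) (L₀ : infChar H) (L : ℝ → infChar H) : Prop :=
  ∀ t : ℝ, ∃ g gm gp : CharGroup H,
    IsExp ((-(t : ℂ)) • f L₀) g ∧ IsBirkhoff g gm gp ∧ L t = Ad gm L₀ ∧ L t = Ad gp L₀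

end HopfLax

end

noncomputable section

namespace HopfLax

/-! ### Coefficients of Laurent series -/

theorem Laurent.coeff_add (a b : Laurent) (n : ℤ) : (a + b).coeff n = a.coeff n + b.coeff n := by
  unfold Laurent.coeff
  rw [map_add, HahnSeries.coeff_add]

@[simp] theorem Laurent.coeff_zero (n : ℤ) : (0 : Laurent).coeff n = 0 := by
  unfold Laurent.coeff
  rw [map_zero, HahnSeries.coeff_zero]

/-- The coefficient of `λⁿ` as a linear form. -/
def Laurent.coeffₗ (n : ℤ) : Laurent →ₗ[ℂ] ℂ where
  toFun a := a.coeff n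
  map_add' a b := Laurent.coeff_add a b n
  map_smul' c a := Laurent.coeff_smul c n a

theorem Laurent.coeff_sum {ι : Type*} (s : Finset ι) (a : ι → Laurent) (n : ℤ) :
    (∑ i ∈ s, a i).coeff n = ∑ i ∈ s, (a i).coeff n :=
  map_sum (Laurent.coeffₗ n) a s

theorem Laurent.coeff_algebraMap (c : ℂ) (n : ℤ) :
    (algebraMap ℂ Laurent c).coeff n = if n = 0 then c else 0 := by
  have h : Laurent.equiv (algebraMap ℂ Laurent c) = HahnSeries.C c := rfl
  unfold Laurent.coeff
  rw [h, HahnSeries.C_apply, HahnSeries.coeff_single]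
  split_ifs <;> rfl

theorem Laurent.coeff_lam_mul (a : Laurent) (n : ℤ) : (lam * a).coeff n = a.coeff (n - 1) := by
  unfold Laurent.coeff lam
  rw [map_mul, RingEquiv.apply_symm_apply, HahnSeries.coeff_single_mul, one_mul]

theorem lam_isUnit : IsUnit lam := by
  refine IsUnit.of_mul_eq_one (Laurent.equiv.symm (HahnSeries.single (-1 : ℤ) (1 : ℂ))) ?_
  rw [lam, ← map_mul, HahnSeries.single_mul_single]
  refine (congrArg _ ?_).trans (map_one Laurent.equiv.symm)
  norm_num

/-- The series with no coefficients below `λᵏ`. -/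
def orderGE (k : ℤ) : Submodule ℂ Laurent where
  carrier := {a | ∀ n < k, a.coeff n = 0}
  add_mem' ha hb n hn := by rw [Laurent.coeff_add, ha n hn, hb n hn, add_zero]
  zero_mem' n _ := Laurent.coeff_zero n
  smul_mem' c a ha n hn := by rw [Laurent.coeff_smul, ha n hn, mul_zero]

/-- The polar series. -/
def polarSeries : Submodule ℂ Laurent where
  carrier := {a | IsPolar a}
  add_mem' ha hb n hn := by rw [Laurent.coeff_add, ha n hn, hb n hn, add_zero]
  zero_mem' n _ := Laurent.coeff_zero n
  smul_mem' c a ha n hn := by rw [Laurent.coeff_smul, ha n hn, mul_zero]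

theorem mul_mem_orderGE {k l : ℤ} {a b : Laurent} (ha : a ∈ orderGE k) (hb : b ∈ orderGE l) :
    a * b ∈ orderGE (k + l) := by
  intro n hn
  unfold Laurent.coeff
  rw [map_mul, HahnSeries.coeff_mul]
  refine Finset.sum_eq_zero fun ij hij => ?_
  have h := (Finset.mem_antidiagonal.mp hij).2.2
  by_cases h1 : ij.1 < k
  · exact mul_eq_zero_of_left (ha _ h1) _
  · exact mul_eq_zero_of_right _ (hb _ (by omega))

theorem mul_mem_polar {a b : Laurent} (ha : a ∈ polarSeries) (hb : b ∈ polarSeries) :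
    a * b ∈ polarSeries := by
  intro n hn
  unfold Laurent.coeff
  rw [map_mul, HahnSeries.coeff_mul]
  refine Finset.sum_eq_zero fun ij hij => ?_
  have h := (Finset.mem_antidiagonal.mp hij).2.2
  by_cases h1 : 0 ≤ ij.1
  · exact mul_eq_zero_of_left (ha _ h1) _
  · exact mul_eq_zero_of_right _ (hb _ (by omega))

theorem mul_mem_orderGE_zero {k : ℤ} {a b : Laurent} (ha : a ∈ orderGE k) (hb : b ∈ orderGE 0) :
    a * b ∈ orderGE k := by simpa using mul_mem_orderGE ha hb

theorem algebraMap_mem_orderGE (c : ℂ) : algebraMap ℂ Laurent c ∈ orderGE 0 := by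
  intro n hn
  rw [Laurent.coeff_algebraMap, if_neg hn.ne]

theorem mul_mem_polar_of_sub {a b : Laurent} (ha : a ∈ polarSeries) {c : ℂ}
    (hb : b - algebraMap ℂ Laurent c ∈ polarSeries) : a * b ∈ polarSeries := by
  have h : a * b = a * (b - algebraMap ℂ Laurent c) + c • a := by
    rw [Algebra.smul_def]; ring
  rw [h]
  exact add_mem (mul_mem_polar ha hb) (polarSeries.smul_mem c ha)

theorem lam_mul_mem_orderGE_zero {a : Laurent} : lam * a ∈ orderGE 0 ↔ a ∈ orderGE (-1) := by
  constructor
  · intro h n hn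
    simpa [Laurent.coeff_lam_mul] using h (n + 1) (by omega)
  · intro h n hn
    rw [Laurent.coeff_lam_mul]
    exact h _ (by omega)

theorem polePart_mem (a : Laurent) : polePart a ∈ polarSeries := by
  intro n hn
  rw [polePart_coeff, if_neg hn.not_gt]

theorem polePart_eq_self {a : Laurent} (ha : a ∈ polarSeries) : polePart a = a := by
  refine Laurent.ext fun n => ?_
  rw [polePart_coeff]
  split_ifs with h
  · rfl
  · exact (ha n (not_lt.mp h)).symm

theorem polePart_eq_zero {a : Laurent} : polePart a = 0 ↔ a ∈ orderGE 0 := by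
  constructor
  · intro h n hn
    have := congrArg (fun b => b.coeff n) h
    simpa [polePart_coeff, hn] using this
  · intro h
    refine Laurent.ext fun n => ?_
    rw [polePart_coeff, Laurent.coeff_zero]
    split_ifs with hn
    · exact h n hn
    · rfl

theorem holPart_apply (a : Laurent) : holPart a = a - polePart a := rfl

theorem expLam_coeff_of_neg (c : ℂ) {n : ℤ} (hn : n < 0) : (expLam c).coeff n = 0 := by
  unfold expLam ofPowerSeries Laurent.coeff
  rw [RingHom.comp_apply, RingHom.coe_coe, RingEquiv.apply_symm_apply,
    HahnSeries.ofPowerSeries_apply]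
  refine HahnSeries.embDomain_of_notMem_range ?_
  rintro ⟨m, hm⟩
  have : (m : ℤ) = n := hm
  omega

theorem expLam_coeff_natCast (c : ℂ) (n : ℕ) :
    (expLam c).coeff n = c ^ n * ((n.factorial : ℂ)⁻¹) := by
  unfold expLam ofPowerSeries Laurent.coeff
  rw [RingHom.comp_apply, RingHom.coe_coe, RingEquiv.apply_symm_apply,
    HahnSeries.ofPowerSeries_apply_coeff, PowerSeries.coeff_rescale, PowerSeries.coeff_exp]
  simp

theorem expLam_mem (c : ℂ) : expLam c ∈ orderGE 0 := fun _ hn => expLam_coeff_of_neg c hn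

theorem hasDerivAt_expLam_coeff (c t : ℂ) (n : ℤ) :
    HasDerivAt (fun s : ℂ => (expLam (s * c)).coeff n) ((c • (lam * expLam (t * c))).coeff n) t := by
  rw [Laurent.coeff_smul, Laurent.coeff_lam_mul]
  rcases lt_or_ge n 0 with hn | hn
  · simp only [expLam_coeff_of_neg _ hn, expLam_coeff_of_neg _ (show n - 1 < 0 by omega), mul_zero]
    exact hasDerivAt_const t 0
  obtain ⟨n, rfl⟩ := Int.eq_ofNat_of_zero_le hn
  simp only [expLam_coeff_natCast]
  cases n with
  | zero =>
    rw [expLam_coeff_of_neg _ (by norm_num)]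
    simpa using hasDerivAt_const t (1 : ℂ)
  | succ k =>
    have h1 : ((k + 1 : ℕ) : ℤ) - 1 = k := by push_cast; ring
    rw [h1, expLam_coeff_natCast]
    have h := (((hasDerivAt_id t).mul_const c).pow (k + 1)).mul_const (((k + 1).factorial : ℂ)⁻¹)
    refine h.congr_deriv ?_
    have h2 : (k.factorial : ℂ) ≠ 0 := by exact_mod_cast k.factorial_ne_zero
    have h3 : (k : ℂ) + 1 ≠ 0 := by exact_mod_cast k.succ_ne_zero
    rw [Nat.factorial_succ]
    push_cast
    simp only [id_eq]
    field_simp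

theorem hasDerivAt_expLam_mul_coeff (c t : ℂ) (a : Laurent) (n : ℤ) :
    HasDerivAt (fun s : ℂ => (expLam (s * c) * a).coeff n)
      ((c • (lam * (expLam (t * c) * a))).coeff n) t := by
  have hs : (Set.Ici (0 : ℤ)).IsPWO := by
    refine Set.IsWF.isPWO ?_
    exact BddBelow.isWF bddBelow_Ici
  have key : ∀ b ∈ orderGE 0, (b * a).coeff n =
      ∑ ij ∈ Finset.antidiagonal hs (Laurent.equiv a).isPWO_support n,
        b.coeff ij.1 * a.coeff ij.2 := by
    intro b hb
    unfold Laurent.coeff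
    rw [map_mul, HahnSeries.coeff_mul_left' hs]
    intro i hi
    by_contra h
    exact hi (hb i (not_le.mp h))
  have h1 : ∀ s : ℂ, c • (lam * (expLam (s * c) * a)) = (c • (lam * expLam (s * c))) * a := by
    intro s
    rw [smul_mul_assoc, mul_assoc]
  have h2 : c • (lam * expLam (t * c)) ∈ orderGE 0 := by
    refine Submodule.smul_mem _ _ fun m hm => ?_
    rw [Laurent.coeff_lam_mul]
    exact expLam_coeff_of_neg _ (by omega)
  rw [h1, key _ h2]
  simp only [key _ (expLam_mem _)]
  exact HasDerivAt.fun_sum fun ij _ => (hasDerivAt_expLam_coeff c t ij.1).mul_const _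

variable {H : Type*} [CommRing H] [HopfAlgebra ℂ H]

/-! ### The convolution algebra -/

theorem conv_add_apply (u v : ConvAlg H) (x : H) : (u + v) x = u x + v x := rfl

theorem conv_sub_apply (u v : ConvAlg H) (x : H) : (u - v) x = u x - v x := rfl

theorem conv_zero_apply (x : H) : (0 : ConvAlg H) x = 0 := rfl

theorem conv_smul_apply (c : ℂ) (u : ConvAlg H) (x : H) : (c • u) x = c • u x := rfl

theorem conv_one_apply (x : H) :
    (1 : ConvAlg H) x = algebraMap ℂ Laurent (CoalgebraStruct.counit (R := ℂ) x) := rfl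

theorem conv_sum_apply {ι : Type*} (s : Finset ι) (u : ι → ConvAlg H) (x : H) :
    (∑ i ∈ s, u i) x = ∑ i ∈ s, u i x := by
  change (∑ i ∈ s, u i).ofConv x = _
  rw [WithConv.ofConv_sum, LinearMap.sum_apply]

theorem conv_map_add (u : ConvAlg H) (x y : H) : u (x + y) = u x + u y := u.ofConv.map_add x y

theorem conv_map_zero (u : ConvAlg H) : u 0 = 0 := u.ofConv.map_zero

theorem conv_map_smul (u : ConvAlg H) (c : ℂ) (x : H) : u (c • x) = c • u x :=
  u.ofConv.map_smul c x

theorem conv_ext {u v : ConvAlg H} (h : ∀ x, u x = v x) : u = v :=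
  WithConv.ext (LinearMap.ext h)

theorem CharGroup.toConvAlg_injective :
    Function.Injective (CharGroup.toConvAlg : CharGroup H → ConvAlg H) := by
  intro φ ψ h
  refine WithConv.ext (AlgHom.ext fun x => ?_)
  exact congrArg (fun u : ConvAlg H => u x) h

theorem CharGroup.mul_inv_conv (φ : CharGroup H) : φ.toConvAlg * (φ⁻¹).toConvAlg = 1 := by
  rw [← CharGroup.toConvAlg_mul, mul_inv_cancel, CharGroup.toConvAlg_one]

theorem CharGroup.inv_mul_conv (φ : CharGroup H) : (φ⁻¹).toConvAlg * φ.toConvAlg = 1 := by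
  rw [← CharGroup.toConvAlg_mul, inv_mul_cancel, CharGroup.toConvAlg_one]

theorem infChar_apply_mul (Z : infChar H) (x y : H) : (Z : ConvAlg H) (x * y) =
    (Z : ConvAlg H) x * algebraMap ℂ Laurent (CoalgebraStruct.counit (R := ℂ) y) +
      algebraMap ℂ Laurent (CoalgebraStruct.counit (R := ℂ) x) * (Z : ConvAlg H) y := Z.2 x y

theorem infChar_apply_one (Z : infChar H) : (Z : ConvAlg H) 1 = 0 := by
  have h := infChar_apply_mul Z 1 1
  rw [mul_one, Bialgebra.counit_one, (algebraMap ℂ Laurent).map_one, mul_one, one_mul] at h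
  simpa using h

theorem Ad_coe (g : CharGroup H) (L : infChar H) :
    (Ad g L : ConvAlg H) = g.toConvAlg * (L : ConvAlg H) * (g⁻¹).toConvAlg := rfl

theorem Ad_mul (g h : CharGroup H) (L : infChar H) : Ad (g * h) L = Ad g (Ad h L) := by
  refine Subtype.ext ?_
  simp only [Ad_coe, mul_inv_rev, CharGroup.toConvAlg_mul, mul_assoc]

theorem Ad_eq_self_iff {g : CharGroup H} {L : infChar H} :
    Ad g L = L ↔ g.toConvAlg * (L : ConvAlg H) = (L : ConvAlg H) * g.toConvAlg := by
  rw [Subtype.ext_iff, Ad_coe]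
  constructor
  · intro h
    calc g.toConvAlg * (L : ConvAlg H)
        = g.toConvAlg * (L : ConvAlg H) * ((g⁻¹).toConvAlg * g.toConvAlg) := by
          rw [g.inv_mul_conv, mul_one]
      _ = (L : ConvAlg H) * g.toConvAlg := by rw [← mul_assoc, h]
  · intro h
    rw [h, mul_assoc, g.mul_inv_conv, mul_one]

theorem bracket_coe (Z Z' : infChar H) :
    (bracket Z Z' : ConvAlg H) = (Z : ConvAlg H) * Z' - (Z' : ConvAlg H) * Z := rfl

theorem projDiff_apply (Z : infChar H) (x : H) : (projDiff Z : ConvAlg H) x =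
    holPart ((Z : ConvAlg H) x) - polePart ((Z : ConvAlg H) x) := rfl

theorem lamMul_apply (Z : infChar H) (x : H) :
    (lamMul Z : ConvAlg H) x = lam * (Z : ConvAlg H) x := rfl

/-! ### The grading -/

variable {𝒜 : ℕ → Submodule ℂ H}

theorem induction_homogeneous [GradedAlgebra 𝒜] {P : H → Prop} (h0 : P 0)
    (hadd : ∀ x y, P x → P y → P (x + y))
    (h : ∀ n, ∀ x ∈ 𝒜 n, P x) (x : H) : P x := by
  induction x using DirectSum.Decomposition.inductionOn 𝒜 with
  | zero => exact h0
  | add a b ha hb => exact hadd a b ha hb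
  | @homogeneous i a => exact h i a a.2

variable (𝒜) in
theorem conv_ext_homogeneous [GradedAlgebra 𝒜] {u v : ConvAlg H}
    (h : ∀ n, ∀ x ∈ 𝒜 n, u x = v x) : u = v := by
  refine conv_ext fun x => induction_homogeneous (𝒜 := 𝒜) ?_ ?_ h x
  · rw [conv_map_zero, conv_map_zero]
  · intro x y hx hy
    rw [conv_map_add, conv_map_add, hx, hy]

variable (𝒜) in
theorem conv_mem_of_homogeneous [GradedAlgebra 𝒜] (S : Submodule ℂ Laurent) {u : ConvAlg H}
    (h : ∀ n, ∀ x ∈ 𝒜 n, u x ∈ S) (x : H) : u x ∈ S := by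
  refine induction_homogeneous (𝒜 := 𝒜) ?_ ?_ h x
  · rw [conv_map_zero]
    exact S.zero_mem
  · intro x y hx hy
    rw [conv_map_add]
    exact S.add_mem hx hy

theorem IsConnectedGradedHopf.exists_repr (h𝒜 : IsConnectedGradedHopf 𝒜) {n : ℕ} {x : H}
    (hx : x ∈ 𝒜 n) : ∃ (k : ℕ) (r : Coalgebra.Repr ℂ x (Fin k)) (p q : Fin k → ℕ),
      ∀ i, p i + q i = n ∧ r.left i ∈ 𝒜 (p i) ∧ r.right i ∈ 𝒜 (q i) := by
  set S : Set (H ⊗[ℂ] H) :=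
    {z | ∃ p q : ℕ, ∃ a b : H, p + q = n ∧ a ∈ 𝒜 p ∧ b ∈ 𝒜 q ∧ z = a ⊗ₜ[ℂ] b} with hS
  have hspan : CoalgebraStruct.comul (R := ℂ) x ∈ Submodule.span ℂ S := by
    refine (iSup₂_le fun p hp => ?_ : _ ≤ Submodule.span ℂ S) (h𝒜.comul_mem n x hx)
    rintro _ ⟨z, rfl⟩
    induction z using TensorProduct.induction_on with
    | zero => rw [map_zero]; exact Submodule.zero_mem _
    | add a b ha hb => rw [map_add]; exact Submodule.add_mem _ ha hb
    | tmul a b =>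
      refine Submodule.subset_span ⟨p.1, p.2, a, b, ?_, a.2, b.2, rfl⟩
      exact Finset.HasAntidiagonal.mem_antidiagonal.mp hp
  obtain ⟨k, c, g, hg⟩ := Submodule.mem_span_set'.mp hspan
  choose p q a b hpq ha hb hz using fun i => (g i).2
  refine ⟨k, ⟨Finset.univ, fun i => c i • a i, b, ?_⟩, p, q, fun i =>
    ⟨hpq i, (𝒜 (p i)).smul_mem _ (ha i), hb i⟩⟩
  rw [← hg]
  refine Finset.sum_congr rfl fun i _ => ?_
  rw [hz, TensorProduct.smul_tmul']

theorem IsConnectedGradedHopf.conv_mem (h𝒜 : IsConnectedGradedHopf 𝒜) (S : Submodule ℂ Laurent)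
    {u v : ConvAlg H} {n : ℕ} {x : H} (hx : x ∈ 𝒜 n)
    (h : ∀ p q, p + q = n → ∀ a ∈ 𝒜 p, ∀ b ∈ 𝒜 q, u a * v b ∈ S) : (u * v) x ∈ S := by
  obtain ⟨k, r, p, q, hr⟩ := h𝒜.exists_repr hx
  rw [r.convMul_apply]
  exact S.sum_mem fun i _ => h _ _ (hr i).1 _ (hr i).2.1 _ (hr i).2.2

theorem IsConnectedGradedHopf.conv_congr (h𝒜 : IsConnectedGradedHopf 𝒜)
    {u v u' v' : ConvAlg H} {n : ℕ} {x : H} (hx : x ∈ 𝒜 n)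
    (h : ∀ p q, p + q = n → ∀ a ∈ 𝒜 p, ∀ b ∈ 𝒜 q, u a * v b = u' a * v' b) :
    (u * v) x = (u' * v') x := by
  obtain ⟨k, r, p, q, hr⟩ := h𝒜.exists_repr hx
  rw [r.convMul_apply, r.convMul_apply]
  exact Finset.sum_congr rfl fun i _ => h _ _ (hr i).1 _ (hr i).2.1 _ (hr i).2.2

variable (𝒜) in
/-- `u` and `v` agree in all degrees below `n`. -/
def EqLT (n : ℕ) (u v : ConvAlg H) : Prop := ∀ m < n, ∀ x ∈ 𝒜 m, u x = v x

variable (𝒜) in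
/-- `u` vanishes in degree zero. -/
def KillsZero (u : ConvAlg H) : Prop := ∀ x ∈ 𝒜 0, u x = 0

theorem EqLT.refl (n : ℕ) (u : ConvAlg H) : EqLT 𝒜 n u u := fun _ _ _ _ => rfl

theorem EqLT.trans {n : ℕ} {u v w : ConvAlg H} (h : EqLT 𝒜 n u v) (h' : EqLT 𝒜 n v w) :
    EqLT 𝒜 n u w := fun m hm x hx => (h m hm x hx).trans (h' m hm x hx)

theorem EqLT.mono {n m : ℕ} {u v : ConvAlg H} (h : EqLT 𝒜 n u v) (hm : m ≤ n) : EqLT 𝒜 m u v :=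
  fun k hk x hx => h k (hk.trans_le hm) x hx

theorem EqLT.add {n : ℕ} {u v u' v' : ConvAlg H} (h : EqLT 𝒜 n u u') (h' : EqLT 𝒜 n v v') :
    EqLT 𝒜 n (u + v) (u' + v') := fun m hm x hx => by
  rw [conv_add_apply, conv_add_apply, h m hm x hx, h' m hm x hx]

theorem EqLT.mul (h𝒜 : IsConnectedGradedHopf 𝒜) {n : ℕ} {u v u' v' : ConvAlg H}
    (h : EqLT 𝒜 n u u') (h' : EqLT 𝒜 n v v') : EqLT 𝒜 n (u * v) (u' * v') :=
  fun m hm x hx => h𝒜.conv_congr hx fun p q hpq a ha b hb => by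
    rw [h p (by omega) a ha, h' q (by omega) b hb]

theorem EqLT.mul_killsZero (h𝒜 : IsConnectedGradedHopf 𝒜) {n : ℕ} {u v u' : ConvAlg H}
    (h : EqLT 𝒜 n u u') (hv : KillsZero 𝒜 v) : EqLT 𝒜 (n + 1) (u * v) (u' * v) :=
  fun m hm x hx => h𝒜.conv_congr hx fun p q hpq a ha b hb => by
    rcases Nat.eq_zero_or_pos q with rfl | hq
    · rw [hv b hb, mul_zero, mul_zero]
    · rw [h p (by omega) a ha]

theorem EqLT.killsZero_mul (h𝒜 : IsConnectedGradedHopf 𝒜) {n : ℕ} {u v u' : ConvAlg H}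
    (h : EqLT 𝒜 n u u') (hv : KillsZero 𝒜 v) : EqLT 𝒜 (n + 1) (v * u) (v * u') :=
  fun m hm x hx => h𝒜.conv_congr hx fun p q hpq a ha b hb => by
    rcases Nat.eq_zero_or_pos p with rfl | hq
    · rw [hv a ha, zero_mul, zero_mul]
    · rw [h q (by omega) b hb]

theorem IsConnectedGradedHopf.algebraMap_counit (h𝒜 : IsConnectedGradedHopf 𝒜) {x : H}
    (hx : x ∈ 𝒜 0) : algebraMap ℂ H (CoalgebraStruct.counit (R := ℂ) x) = x := by
  obtain ⟨c, rfl⟩ := h𝒜.connected x hx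
  rw [Bialgebra.counit_algebraMap]

theorem IsConnectedGradedHopf.char_apply (h𝒜 : IsConnectedGradedHopf 𝒜) (φ : CharGroup H) {x : H}
    (hx : x ∈ 𝒜 0) : φ.toConvAlg x = (1 : ConvAlg H) x := by
  conv_lhs => rw [← h𝒜.algebraMap_counit hx]
  exact φ.ofConv.commutes _

theorem IsConnectedGradedHopf.char_sub_one (h𝒜 : IsConnectedGradedHopf 𝒜) (φ : CharGroup H) :
    KillsZero 𝒜 (φ.toConvAlg - 1) := fun x hx => by
  rw [conv_sub_apply, h𝒜.char_apply φ hx, sub_self]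

theorem IsConnectedGradedHopf.infChar_killsZero (h𝒜 : IsConnectedGradedHopf 𝒜) (Z : infChar H) :
    KillsZero 𝒜 (Z : ConvAlg H) := fun x hx => by
  rw [← h𝒜.algebraMap_counit hx, Algebra.algebraMap_eq_smul_one, conv_map_smul,
    infChar_apply_one, smul_zero]

theorem IsConnectedGradedHopf.one_apply (h𝒜 : IsConnectedGradedHopf 𝒜) {n : ℕ} (hn : n ≠ 0)
    {x : H} (hx : x ∈ 𝒜 n) : (1 : ConvAlg H) x = 0 := by
  rw [conv_one_apply, h𝒜.counit_eq_zero n hn x hx, map_zero]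

/-- A sequence of linear maps which stabilizes in every degree has a limit. -/
theorem exists_limit [GradedAlgebra 𝒜] (a : ℕ → ConvAlg H) (h : ∀ N, EqLT 𝒜 N (a N) (a (N + 1))) :
    ∃ u : ConvAlg H, ∀ N, EqLT 𝒜 N u (a N) := by
  have hle : ∀ N k, EqLT 𝒜 N (a N) (a (N + k)) := by
    intro N k
    induction k with
    | zero => exact EqLT.refl N _
    | succ k ih => exact ih.trans ((h (N + k)).mono (Nat.le_add_right N k))
  refine ⟨WithConv.toConv (DirectSum.toModule ℂ ℕ Laurent
    (fun n => (a (n + 1)).ofConv ∘ₗ (𝒜 n).subtype) ∘ₗ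
      (DirectSum.decomposeLinearEquiv 𝒜).toLinearMap), fun N m hm x hx => ?_⟩
  obtain ⟨k, rfl⟩ := Nat.exists_eq_add_of_le (Nat.succ_le_of_lt hm)
  refine Eq.trans ?_ (hle (m + 1) k m (Nat.lt_succ_self m) x hx)
  have h : DirectSum.decomposeLinearEquiv 𝒜 x = DirectSum.lof ℂ ℕ (fun i => 𝒜 i) m ⟨x, hx⟩ :=
    DirectSum.decomposeLinearEquiv_apply_coe 𝒜 m ⟨x, hx⟩
  change (DirectSum.toModule ℂ ℕ Laurent _ ∘ₗ (DirectSum.decomposeLinearEquiv 𝒜).toLinearMap) x = _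
  rw [LinearMap.comp_apply, LinearEquiv.coe_coe, h, DirectSum.toModule_lof]
  rfl

/-- A map which improves agreement by one degree has a fixed point, which is approximated by its
iterates. -/
theorem exists_fixedPoint [GradedAlgebra 𝒜] (T : ConvAlg H → ConvAlg H)
    (hT : ∀ n u v, EqLT 𝒜 n u v → EqLT 𝒜 (n + 1) (T u) (T v)) :
    ∃ u, T u = u ∧ ∀ N, EqLT 𝒜 N u (T^[N] 0) := by
  have hstep : ∀ N, EqLT 𝒜 N (T^[N] 0) (T^[N + 1] 0) := by
    intro N
    induction N with
    | zero => exact fun m hm => absurd hm (Nat.not_lt_zero m)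
    | succ N ih =>
      rw [Function.iterate_succ_apply' T (N + 1), Function.iterate_succ_apply' T N]
      rw [Function.iterate_succ_apply' T N] at ih
      exact hT N _ _ ih
  obtain ⟨u, hu⟩ := exists_limit _ hstep
  refine ⟨u, conv_ext_homogeneous 𝒜 fun n x hx => ?_, hu⟩
  have h1 := hT n _ _ (hu n) n (Nat.lt_succ_self n) x hx
  rw [← Function.iterate_succ_apply' T n] at h1
  exact h1.trans (hu (n + 1) n (Nat.lt_succ_self n) x hx).symm

theorem mem_infChar_of_approx [GradedAlgebra 𝒜] {u : ConvAlg H}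
    (h : ∀ N, ∃ Z : infChar H, EqLT 𝒜 N u (Z : ConvAlg H)) : u ∈ infChar H := by
  intro x y
  refine induction_homogeneous (𝒜 := 𝒜) (P := fun x => u (x * y) =
    u x * algebraMap ℂ Laurent (CoalgebraStruct.counit (R := ℂ) y) +
      algebraMap ℂ Laurent (CoalgebraStruct.counit (R := ℂ) x) * u y)
    ?_ ?_ (fun m x hx => ?_) x
  · simp only [zero_mul, map_zero, add_zero]
  · intro a b ha hb
    rw [add_mul, conv_map_add, ha, hb, conv_map_add, map_add, RingHom.map_add]
    ring
  refine induction_homogeneous (𝒜 := 𝒜) (P := fun y => u (x * y) =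
    u x * algebraMap ℂ Laurent (CoalgebraStruct.counit (R := ℂ) y) +
      algebraMap ℂ Laurent (CoalgebraStruct.counit (R := ℂ) x) * u y)
    ?_ ?_ (fun n y hy => ?_) y
  · simp only [mul_zero, map_zero, add_zero]
  · intro a b ha hb
    rw [mul_add, conv_map_add, ha, hb, conv_map_add, map_add, RingHom.map_add]
    ring
  obtain ⟨Z, hZ⟩ := h (m + n + 1)
  rw [hZ (m + n) (by omega) _ (SetLike.mul_mem_graded hx hy), hZ m (by omega) x hx,
    hZ n (by omega) y hy, infChar_apply_mul]

variable (𝒜) in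
theorem infChar_exists_fixedPoint [GradedAlgebra 𝒜] (T : infChar H → infChar H)
    (hT : ∀ n (u v : infChar H), EqLT 𝒜 n (u : ConvAlg H) v →
      EqLT 𝒜 (n + 1) (T u : ConvAlg H) (T v)) : ∃ Z, T Z = Z := by
  have hstep : ∀ N, EqLT 𝒜 N (T^[N] 0 : ConvAlg H) (T^[N + 1] 0 : infChar H) := by
    intro N
    induction N with
    | zero => exact fun m hm => absurd hm (Nat.not_lt_zero m)
    | succ N ih =>
      rw [Function.iterate_succ_apply' T (N + 1), Function.iterate_succ_apply' T N]
      rw [Function.iterate_succ_apply' T N] at ih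
      exact hT N _ _ ih
  obtain ⟨u, hu⟩ := exists_limit _ hstep
  have hmem : u ∈ infChar H := mem_infChar_of_approx fun N => ⟨_, hu N⟩
  refine ⟨⟨u, hmem⟩, Subtype.ext (conv_ext_homogeneous 𝒜 fun n x hx => ?_)⟩
  have h1 := hT n ⟨u, hmem⟩ _ (hu n) n (Nat.lt_succ_self n) x hx
  rw [← Function.iterate_succ_apply' T n] at h1
  exact h1.trans (hu (n + 1) n (Nat.lt_succ_self n) x hx).symm

/-! ### The grading derivation and `R̃` -/

variable (𝒜) in
/-- The derivation `u ↦ u ∘ Y` of the convolution algebra. -/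
def compY [GradedAlgebra 𝒜] (u : ConvAlg H) : ConvAlg H :=
  WithConv.toConv (u.ofConv ∘ₗ gradingOp 𝒜)

theorem compY_apply [GradedAlgebra 𝒜] (u : ConvAlg H) {n : ℕ} {x : H} (hx : x ∈ 𝒜 n) :
    compY 𝒜 u x = (n : ℂ) • u x := by
  change u.ofConv (gradingOp 𝒜 x) = _
  rw [gradingOp_apply 𝒜 hx, map_smul]

theorem compY_mul [GradedAlgebra 𝒜] (h𝒜 : IsConnectedGradedHopf 𝒜) (u v : ConvAlg H) :
    compY 𝒜 (u * v) = compY 𝒜 u * v + u * compY 𝒜 v := by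
  refine conv_ext_homogeneous 𝒜 fun n x hx => ?_
  obtain ⟨k, r, p, q, hr⟩ := h𝒜.exists_repr hx
  rw [compY_apply _ hx, conv_add_apply, r.convMul_apply, r.convMul_apply, r.convMul_apply,
    Finset.smul_sum, ← Finset.sum_add_distrib]
  refine Finset.sum_congr rfl fun i _ => ?_
  rw [compY_apply _ (hr i).2.1, compY_apply _ (hr i).2.2, ← (hr i).1, Nat.cast_add, add_smul,
    smul_mul_assoc, mul_smul_comm]

theorem char_mul_Rtilde [GradedAlgebra 𝒜] (φ : CharGroup H) :
    φ.toConvAlg * (Rtilde 𝒜 φ : ConvAlg H) = compY 𝒜 φ.toConvAlg := by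
  change φ.toConvAlg * ((φ⁻¹).toConvAlg * compY 𝒜 φ.toConvAlg) = _
  rw [← mul_assoc, φ.mul_inv_conv, one_mul]

theorem Rtilde_eq_of_mul [GradedAlgebra 𝒜] {φ : CharGroup H} {Z : infChar H}
    (h : φ.toConvAlg * (Z : ConvAlg H) = compY 𝒜 φ.toConvAlg) : Rtilde 𝒜 φ = Z := by
  refine Subtype.ext ?_
  change (φ⁻¹).toConvAlg * compY 𝒜 φ.toConvAlg = _
  rw [← h, ← mul_assoc, φ.inv_mul_conv, one_mul]

theorem Rtilde_mul [GradedAlgebra 𝒜] (h𝒜 : IsConnectedGradedHopf 𝒜) (φ ψ : CharGroup H) :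
    Rtilde 𝒜 (φ * ψ) = Ad ψ⁻¹ (Rtilde 𝒜 φ) + Rtilde 𝒜 ψ := by
  refine Rtilde_eq_of_mul ?_
  rw [CharGroup.toConvAlg_mul, compY_mul h𝒜, ← char_mul_Rtilde, ← char_mul_Rtilde]
  change _ * ((ψ⁻¹).toConvAlg * (Rtilde 𝒜 φ : ConvAlg H) * (ψ⁻¹⁻¹).toConvAlg +
    (Rtilde 𝒜 ψ : ConvAlg H)) = _
  rw [inv_inv, mul_add, mul_assoc, mul_assoc]
  congr 1
  rw [← mul_assoc, ← mul_assoc, mul_assoc φ.toConvAlg, ψ.mul_inv_conv, mul_one, mul_assoc]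
  rw [mul_assoc]

theorem IsConnectedGradedHopf.Rtilde_injective [GradedAlgebra 𝒜] (h𝒜 : IsConnectedGradedHopf 𝒜) :
    Function.Injective (Rtilde 𝒜) := by
  intro φ ψ h
  have key : ∀ n, EqLT 𝒜 n φ.toConvAlg ψ.toConvAlg := by
    intro n
    induction n with
    | zero => exact fun m hm => absurd hm (Nat.not_lt_zero m)
    | succ n ih =>
      intro m hm x hx
      rcases Nat.eq_zero_or_pos m with rfl | hm0
      · rw [h𝒜.char_apply φ hx, h𝒜.char_apply ψ hx]
      have h1 := ih.mul_killsZero h𝒜 (h𝒜.infChar_killsZero (Rtilde 𝒜 φ)) m hm x hx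
      rw [char_mul_Rtilde, h, char_mul_Rtilde, compY_apply _ hx, compY_apply _ hx] at h1
      have h2 : (m : ℂ) ≠ 0 := by exact_mod_cast hm0.ne'
      exact (isUnit_iff_ne_zero.mpr h2).smul_left_cancel.mp h1
  exact CharGroup.toConvAlg_injective
    (conv_ext_homogeneous 𝒜 fun n x hx => key (n + 1) n (Nat.lt_succ_self n) x hx)

theorem sum_right_counit_smul {ι : Type*} {x : H} (r : Coalgebra.Repr ℂ x ι) :
    ∑ i ∈ r.index, CoalgebraStruct.counit (R := ℂ) (r.right i) • r.left i = x := by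
  have h := congrArg (TensorProduct.lift (LinearMap.lsmul ℂ H).flip)
    (Coalgebra.sum_tmul_counit_eq (R := ℂ) r)
  simpa only [map_sum, TensorProduct.lift.tmul, LinearMap.flip_apply, LinearMap.lsmul_apply,
    one_smul] using h

theorem conv_map_mul_of_homogeneous [GradedAlgebra 𝒜] {u : ConvAlg H}
    (h : ∀ m n, ∀ x ∈ 𝒜 m, ∀ y ∈ 𝒜 n, u (x * y) = u x * u y) (x y : H) :
    u (x * y) = u x * u y := by
  refine induction_homogeneous (𝒜 := 𝒜) (P := fun x => u (x * y) = u x * u y)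
    ?_ ?_ (fun m x hx => ?_) x
  · rw [zero_mul, conv_map_zero, zero_mul]
  · intro a b ha hb
    rw [add_mul, conv_map_add, ha, hb, conv_map_add, add_mul]
  refine induction_homogeneous (𝒜 := 𝒜) (P := fun y => u (x * y) = u x * u y)
    ?_ ?_ (fun n y hy => h m n x hx y hy) y
  · rw [mul_zero, conv_map_zero, mul_zero]
  · intro a b ha hb
    rw [mul_add, conv_map_add, ha, hb, conv_map_add, mul_add]

/-- A linear map `u` with `u ⋆ Z = u ∘ Y` for an infinitesimal character `Z` is multiplicative. -/
theorem IsConnectedGradedHopf.map_mul_of_compY [GradedAlgebra 𝒜] (h𝒜 : IsConnectedGradedHopf 𝒜)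
    {u : ConvAlg H} (Z : infChar H) (h : u * (Z : ConvAlg H) = compY 𝒜 u) (h1 : u 1 = 1)
    (x y : H) : u (x * y) = u x * u y := by
  have key : ∀ N m n, m + n = N → ∀ x ∈ 𝒜 m, ∀ y ∈ 𝒜 n, u (x * y) = u x * u y := by
    intro N
    induction N using Nat.strong_induction_on with
    | _ N ih =>
      intro m n hmn x hx y hy
      rcases Nat.eq_zero_or_pos N with rfl | hN
      · obtain ⟨rfl, rfl⟩ : m = 0 ∧ n = 0 := by omega
        obtain ⟨c, rfl⟩ := h𝒜.connected x hx
        rw [← Algebra.smul_def, conv_map_smul, Algebra.algebraMap_eq_smul_one, conv_map_smul, h1,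
          smul_one_mul]
      obtain ⟨k, r, p, q, hr⟩ := h𝒜.exists_repr hx
      obtain ⟨k', r', p', q', hr'⟩ := h𝒜.exists_repr hy
      have hN' : ((m + n : ℕ) : ℂ) ≠ 0 := by exact_mod_cast (hmn ▸ hN).ne'
      refine (isUnit_iff_ne_zero.mpr hN').smul_left_cancel.mp ?_
      have e1 : ((m + n : ℕ) : ℂ) • u (x * y) = (u * (Z : ConvAlg H)) (x * y) := by
        rw [h, compY_apply _ (SetLike.mul_mem_graded hx hy)]
      have e2 : ((m + n : ℕ) : ℂ) • (u x * u y) =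
          (u * (Z : ConvAlg H)) x * u y + u x * (u * (Z : ConvAlg H)) y := by
        rw [h, compY_apply _ hx, compY_apply _ hy, Nat.cast_add, add_smul, smul_mul_assoc,
          mul_smul_comm]
      have hx1 : ∀ b, u (x * b) = ∑ i ∈ r.index, u (r.left i * b) *
          algebraMap ℂ Laurent (CoalgebraStruct.counit (R := ℂ) (r.right i)) := by
        intro b
        conv_lhs => rw [← sum_right_counit_smul r, Finset.sum_mul]
        refine (map_sum u.ofConv _ _).trans (Finset.sum_congr rfl fun i _ => ?_)
        rw [smul_mul_assoc, map_smul, Algebra.smul_def, mul_comm]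
      have hy1 : ∀ a, u (a * y) = ∑ j ∈ r'.index, u (a * r'.left j) *
          algebraMap ℂ Laurent (CoalgebraStruct.counit (R := ℂ) (r'.right j)) := by
        intro a
        conv_lhs => rw [← sum_right_counit_smul r', Finset.mul_sum]
        refine (map_sum u.ofConv _ _).trans (Finset.sum_congr rfl fun i _ => ?_)
        rw [mul_smul_comm, map_smul, Algebra.smul_def, mul_comm]
      have e3 : (u * (Z : ConvAlg H)) (x * y) =
          ∑ i ∈ r.index, u (r.left i * y) * (Z : ConvAlg H) (r.right i) +
            ∑ j ∈ r'.index, u (x * r'.left j) * (Z : ConvAlg H) (r'.right j) := by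
        rw [(r.mul r').convMul_apply]
        rw [Coalgebra.Repr.mul_index, Finset.sum_product]
        simp only [Coalgebra.Repr.mul_left, Coalgebra.Repr.mul_right, hx1, hy1, Finset.sum_mul,
          infChar_apply_mul, mul_add, Finset.sum_add_distrib]
        congr 1
        · refine Finset.sum_congr rfl fun i _ => Finset.sum_congr rfl fun j _ => ?_
          ring
        · rw [Finset.sum_comm]
          refine Finset.sum_congr rfl fun i _ => Finset.sum_congr rfl fun j _ => ?_
          ring
      rw [e1, e2, e3, r.convMul_apply, r'.convMul_apply, Finset.sum_mul, Finset.mul_sum]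
      congr 1
      · refine Finset.sum_congr rfl fun i _ => ?_
        rcases Nat.eq_zero_or_pos (q i) with hq | hq
        · rw [h𝒜.infChar_killsZero Z _ (hq ▸ (hr i).2.2)]
          ring
        · rw [ih (p i + n) (by have := (hr i).1; omega) _ _ rfl _ (hr i).2.1 _ hy]
          ring
      · refine Finset.sum_congr rfl fun i _ => ?_
        rcases Nat.eq_zero_or_pos (q' i) with hq | hq
        · rw [h𝒜.infChar_killsZero Z _ (hq ▸ (hr' i).2.2)]
          ring
        · rw [ih (m + p' i) (by have := (hr' i).1; omega) _ _ rfl _ hx _ (hr' i).2.1]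
          ring
  exact conv_map_mul_of_homogeneous (fun m n x hx y hy => key _ m n rfl x hx y hy) x y

/-- A multiplicative unital element of the convolution algebra, as a character. -/
def charOfConv (u : ConvAlg H) (h1 : u 1 = 1) (hmul : ∀ x y, u (x * y) = u x * u y) :
    CharGroup H :=
  WithConv.toConv (AlgHom.ofLinearMap u.ofConv h1 hmul)

variable (𝒜) in
/-- The linear map `u ↦ u ∘ Y⁻¹`, with `Y⁻¹ = 0` in degree zero. -/
def compYInv [GradedAlgebra 𝒜] (u : ConvAlg H) : ConvAlg H :=
  WithConv.toConv (u.ofConv ∘ₗ DirectSum.toModule ℂ ℕ H (fun n => (n : ℂ)⁻¹ • (𝒜 n).subtype) ∘ₗ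
    (DirectSum.decomposeLinearEquiv 𝒜).toLinearMap)

theorem compYInv_apply [GradedAlgebra 𝒜] (u : ConvAlg H) {n : ℕ} {x : H} (hx : x ∈ 𝒜 n) :
    compYInv 𝒜 u x = (n : ℂ)⁻¹ • u x := by
  have h : DirectSum.decomposeLinearEquiv 𝒜 x = DirectSum.lof ℂ ℕ (fun i => 𝒜 i) n ⟨x, hx⟩ :=
    DirectSum.decomposeLinearEquiv_apply_coe 𝒜 n ⟨x, hx⟩
  change u.ofConv (DirectSum.toModule ℂ ℕ H _ (DirectSum.decomposeLinearEquiv 𝒜 x)) = _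
  rw [h, DirectSum.toModule_lof, LinearMap.smul_apply, map_smul]
  rfl

theorem IsConnectedGradedHopf.Rtilde_surjective [GradedAlgebra 𝒜] (h𝒜 : IsConnectedGradedHopf 𝒜) :
    Function.Surjective (Rtilde 𝒜) := by
  intro Z
  obtain ⟨u, hu, -⟩ := exists_fixedPoint (𝒜 := 𝒜)
    (fun u => 1 + compYInv 𝒜 (u * (Z : ConvAlg H))) fun n u v huv =>
      (EqLT.refl (n + 1) 1).add fun m hm x hx => by
        rw [compYInv_apply _ hx, compYInv_apply _ hx,
          huv.mul_killsZero h𝒜 (h𝒜.infChar_killsZero Z) m hm x hx]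
  have hY : u * (Z : ConvAlg H) = compY 𝒜 u := by
    refine conv_ext_homogeneous 𝒜 fun n x hx => ?_
    rw [compY_apply _ hx]
    rcases Nat.eq_zero_or_pos n with rfl | hn
    · rw [Nat.cast_zero, zero_smul]
      refine (h𝒜.conv_congr hx fun p q hpq a ha b hb => ?_ : _ = (u * 0) x).trans ?_
      · obtain rfl : q = 0 := by omega
        rw [h𝒜.infChar_killsZero Z b hb, conv_zero_apply]
      · rw [mul_zero, conv_zero_apply]
    · have h2 : (n : ℂ) ≠ 0 := by exact_mod_cast hn.ne'
      conv_rhs => rw [← hu]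
      rw [conv_add_apply, h𝒜.one_apply hn.ne' hx, zero_add, compYInv_apply _ hx, smul_smul,
        mul_inv_cancel₀ h2, one_smul]
  have h1 : u 1 = 1 := by
    rw [← hu, conv_add_apply, compYInv_apply _ SetLike.GradedOne.one_mem, Nat.cast_zero, inv_zero,
      zero_smul, add_zero, conv_one_apply, Bialgebra.counit_one, (algebraMap ℂ Laurent).map_one]
  exact ⟨charOfConv u h1 (h𝒜.map_mul_of_compY Z hY h1), Rtilde_eq_of_mul hY⟩

theorem IsConnectedGradedHopf.Rtilde_bijective [GradedAlgebra 𝒜] (h𝒜 : IsConnectedGradedHopf 𝒜) :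
    Function.Bijective (Rtilde 𝒜) := ⟨h𝒜.Rtilde_injective, h𝒜.Rtilde_surjective⟩

theorem lamMul_bijective : Function.Bijective (lamMul : infChar H → infChar H) := by
  obtain ⟨⟨l, l', hl, hl'⟩, rfl : l = lam⟩ := lam_isUnit
  constructor
  · intro Z Z' h
    refine Subtype.ext (conv_ext fun x => ?_)
    have h1 := congrArg (fun W : infChar H => l' * (W : ConvAlg H) x) h
    simpa only [lamMul_apply, ← mul_assoc, hl', one_mul] using h1
  · intro Z
    refine ⟨⟨WithConv.toConv (LinearMap.mulLeft ℂ l' ∘ₗ (Z : ConvAlg H).ofConv), ?_⟩, ?_⟩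
    · intro x y
      change l' * (Z : ConvAlg H) (x * y) =
        (l' * (Z : ConvAlg H) x) * _ + _ * (l' * (Z : ConvAlg H) y)
      rw [Z.2 x y]
      ring
    · refine Subtype.ext (conv_ext fun x => ?_)
      change lam * (l' * (Z : ConvAlg H) x) = _
      rw [← mul_assoc, hl, one_mul]

theorem IsConnectedGradedHopf.lamRtilde_bijective [GradedAlgebra 𝒜]
    (h𝒜 : IsConnectedGradedHopf 𝒜) : Function.Bijective (lamRtilde 𝒜) :=
  lamMul_bijective.comp h𝒜.Rtilde_bijective

/-! ### Existence of the Birkhoff decomposition -/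

theorem conv_mul_mem_orderGE {k : ℤ} {u v : ConvAlg H} (hu : ∀ x, u x ∈ orderGE k)
    (hv : ∀ x, v x ∈ orderGE 0) (x : H) : (u * v) x ∈ orderGE k := by
  rw [(Coalgebra.Repr.arbitrary ℂ x).convMul_apply]
  exact Submodule.sum_mem _ fun i _ => mul_mem_orderGE_zero (hu _) (hv _)

theorem conv_one_mem_orderGE (x : H) : (1 : ConvAlg H) x ∈ orderGE 0 :=
  algebraMap_mem_orderGE _

theorem CharGroup.inv_mem {S : Submodule ℂ Laurent} {φ : CharGroup H}
    (h : ∀ x, φ.toConvAlg x ∈ S) (x : H) : (φ⁻¹).toConvAlg x ∈ S := h _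

/-- If `R̃(φ)` takes values in a non-unital subalgebra, then so does `φ - ε`. -/
theorem IsConnectedGradedHopf.sub_one_mem_of_Rtilde [GradedAlgebra 𝒜]
    (h𝒜 : IsConnectedGradedHopf 𝒜) (S : Submodule ℂ Laurent)
    (hS : ∀ a ∈ S, ∀ b ∈ S, a * b ∈ S) {φ : CharGroup H}
    (h : ∀ x, (Rtilde 𝒜 φ : ConvAlg H) x ∈ S) (x : H) : (φ.toConvAlg - 1) x ∈ S := by
  refine conv_mem_of_homogeneous 𝒜 S (fun n => ?_) x
  induction n using Nat.strong_induction_on with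
  | _ n ih =>
    intro x hx
    rcases Nat.eq_zero_or_pos n with rfl | hn
    · rw [h𝒜.char_sub_one φ x hx]
      exact S.zero_mem
    have h2 : (n : ℂ) ≠ 0 := by exact_mod_cast hn.ne'
    have e : (φ.toConvAlg - 1) x = (n : ℂ)⁻¹ • ((φ.toConvAlg - 1) * (Rtilde 𝒜 φ : ConvAlg H) +
        (Rtilde 𝒜 φ : ConvAlg H)) x := by
      rw [sub_mul, one_mul, sub_add_cancel, char_mul_Rtilde, compY_apply _ hx, smul_smul,
        inv_mul_cancel₀ h2, one_smul, conv_sub_apply, h𝒜.one_apply hn.ne' hx, sub_zero]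
    rw [e, conv_add_apply]
    refine S.smul_mem _ (S.add_mem (h𝒜.conv_mem S hx fun p q hpq a ha b hb => ?_) (h x))
    rcases Nat.eq_zero_or_pos q with rfl | hq
    · rw [h𝒜.infChar_killsZero _ b hb, mul_zero]
      exact S.zero_mem
    · exact hS _ (ih p (by omega) a ha) _ (h b)

/-- The pole part of an infinitesimal character. -/
def poleInf (Z : infChar H) : infChar H := (1 / 2 : ℂ) • (Z - projDiff Z)

theorem poleInf_apply (Z : infChar H) (x : H) :
    (poleInf Z : ConvAlg H) x = polePart ((Z : ConvAlg H) x) := by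
  change (1 / 2 : ℂ) • ((Z : ConvAlg H) x - (projDiff Z : ConvAlg H) x) = _
  rw [projDiff_apply, holPart_apply, sub_sub, sub_sub_cancel, ← two_smul ℂ, smul_smul]
  norm_num

theorem Ad_inv_sub_coe (φ : CharGroup H) (Z : infChar H) :
    ((Ad φ⁻¹ Z - Z : infChar H) : ConvAlg H) =
      ((φ⁻¹).toConvAlg - 1) * ((Z : ConvAlg H) * φ.toConvAlg) +
        (Z : ConvAlg H) * (φ.toConvAlg - 1) := by
  change (φ⁻¹).toConvAlg * (Z : ConvAlg H) * (φ⁻¹⁻¹).toConvAlg - (Z : ConvAlg H) = _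
  rw [inv_inv, sub_mul, mul_sub, one_mul, mul_one, mul_assoc]
  abel

theorem IsConnectedGradedHopf.exists_isBirkhoff [GradedAlgebra 𝒜] (h𝒜 : IsConnectedGradedHopf 𝒜)
    (φ : CharGroup H) : ∃ φm φp : CharGroup H, IsBirkhoff φ φm φp := by
  obtain ⟨Z, hZ⟩ := infChar_exists_fixedPoint 𝒜
    (fun Z => -poleInf (Rtilde 𝒜 φ + (Ad φ⁻¹ Z - Z))) fun n u v huv m hm x hx => by
      change -((poleInf _ : infChar H) : ConvAlg H) x = -((poleInf _ : infChar H) : ConvAlg H) x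
      have h : ((Ad φ⁻¹ u - u : infChar H) : ConvAlg H) x =
          ((Ad φ⁻¹ v - v : infChar H) : ConvAlg H) x := by
        rw [Ad_inv_sub_coe, Ad_inv_sub_coe]
        exact (((huv.mul h𝒜 (EqLT.refl n φ.toConvAlg)).killsZero_mul h𝒜
          (h𝒜.char_sub_one φ⁻¹)).add (huv.mul_killsZero h𝒜 (h𝒜.char_sub_one φ))) m hm x hx
      rw [poleInf_apply, poleInf_apply]
      exact congrArg (fun w => -polePart ((Rtilde 𝒜 φ : ConvAlg H) x + w)) h
  have hZx : ∀ x, (Z : ConvAlg H) x = -polePart ((Rtilde 𝒜 φ : ConvAlg H) x +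
      ((Ad φ⁻¹ Z : ConvAlg H) x - (Z : ConvAlg H) x)) := fun x => by
    conv_lhs => rw [← hZ]
    change -((poleInf _ : infChar H) : ConvAlg H) x = _
    rw [poleInf_apply]
    rfl
  have hpolar : ∀ x, (Z : ConvAlg H) x ∈ polarSeries := fun x => by
    rw [hZx]
    exact polarSeries.neg_mem (polePart_mem _)
  have hhol : ∀ x, ((Ad φ⁻¹ Z + Rtilde 𝒜 φ : infChar H) : ConvAlg H) x ∈ orderGE 0 := fun x => by
    change (Ad φ⁻¹ Z : ConvAlg H) x + (Rtilde 𝒜 φ : ConvAlg H) x ∈ orderGE 0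
    rw [← polePart_eq_zero, map_add]
    have h := hZx x
    rw [map_add, map_sub, polePart_eq_self (hpolar x)] at h
    linear_combination h
  obtain ⟨φm, rfl⟩ := h𝒜.Rtilde_surjective Z
  refine ⟨φm, φm * φ, by rw [inv_mul_cancel_left], fun x hx => ?_, fun x => ?_⟩
  · have h := h𝒜.sub_one_mem_of_Rtilde polarSeries (fun a ha b hb => mul_mem_polar ha hb) hpolar x
    rw [conv_sub_apply, conv_one_apply, hx, map_zero, sub_zero] at h
    exact h
  · have h := h𝒜.sub_one_mem_of_Rtilde (φ := φm * φ) (orderGE 0)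
      (fun a ha b hb => mul_mem_orderGE_zero ha hb) (by rw [Rtilde_mul h𝒜]; exact hhol) x
    have h' := add_mem h (conv_one_mem_orderGE x)
    rwa [conv_sub_apply, sub_add_cancel] at h'

theorem IsBirkhoff.sub_one_mem_polar {φ φm φp : CharGroup H} (h : IsBirkhoff φ φm φp) (x : H) :
    (φm.toConvAlg - 1) x ∈ polarSeries := by
  set c := CoalgebraStruct.counit (R := ℂ) x with hc
  have h0 := h.polar (x - algebraMap ℂ H c) (by
    rw [map_sub, Bialgebra.counit_algebraMap, ← hc, sub_self])
  have e : (φm.toConvAlg - 1) x = φm.ofConv (x - algebraMap ℂ H c) := by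
    rw [map_sub, AlgHom.commutes]
    rfl
  rw [e]
  exact h0

theorem IsBirkhoff.inv_sub_one_mem_polar {φ φm φp : CharGroup H} (h : IsBirkhoff φ φm φp)
    (x : H) : ((φm⁻¹).toConvAlg - 1) x ∈ polarSeries := by
  have h1 := h.sub_one_mem_polar (HopfAlgebra.antipode ℂ x)
  rw [conv_sub_apply, conv_one_apply] at h1 ⊢
  rwa [HopfAlgebra.counit_antipode] at h1

/-! ### The exponential -/

/-- The partial sums of the exponential series. -/
def expSum (u : ConvAlg H) (N : ℕ) : ConvAlg H :=
  ∑ k ∈ Finset.range N, ((k.factorial : ℂ)⁻¹) • u ^ k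

theorem KillsZero.pow (h𝒜 : IsConnectedGradedHopf 𝒜) {u : ConvAlg H} (hu : KillsZero 𝒜 u)
    (k : ℕ) : EqLT 𝒜 k (u ^ k) 0 := by
  induction k with
  | zero => exact fun m hm => absurd hm (Nat.not_lt_zero m)
  | succ k ih =>
    have h := ih.mul_killsZero h𝒜 hu
    rwa [zero_mul, ← pow_succ] at h

theorem conv_mul_infChar_apply_mul (W : ConvAlg H) (Z : infChar H) {ι : Type*} (s : Finset ι)
    (A B : ι → ConvAlg H) (h : ∀ x y, W (x * y) = ∑ i ∈ s, A i x * B i y) (x y : H) :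
    (W * (Z : ConvAlg H)) (x * y) =
      ∑ i ∈ s, ((A i * (Z : ConvAlg H)) x * B i y + A i x * (B i * (Z : ConvAlg H)) y) := by
  have e1 : ∀ i, (A i * (Z : ConvAlg H)) x * B i y =
      (A i * (Z : ConvAlg H)) x * (B i * 1) y := fun i => by rw [mul_one]
  have e2 : ∀ i, A i x * (B i * (Z : ConvAlg H)) y =
      (A i * 1) x * (B i * (Z : ConvAlg H)) y := fun i => by rw [mul_one]
  rw [conv_apply_mul]
  simp only [e1, e2, conv_apply_mul_conv_apply, ← Finset.sum_add_distrib]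
  rw [Finset.sum_comm]
  conv_rhs => rw [Finset.sum_comm]
  rw [Finset.sum_comm]
  refine Finset.sum_congr rfl fun i _ => ?_
  rw [Finset.sum_comm]
  refine Finset.sum_congr rfl fun j _ => ?_
  rw [h, infChar_apply_mul, Finset.sum_mul]
  refine Finset.sum_congr rfl fun l _ => ?_
  rw [conv_one_apply, conv_one_apply]
  ring

theorem infChar_pow_apply_mul (Z : infChar H) (k : ℕ) (x y : H) :
    ((Z : ConvAlg H) ^ k) (x * y) = ∑ ij ∈ Finset.HasAntidiagonal.antidiagonal k,
      k.choose ij.1 • (((Z : ConvAlg H) ^ ij.1) x * ((Z : ConvAlg H) ^ ij.2) y) := by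
  induction k generalizing x y with
  | zero =>
    simp only [Finset.Nat.antidiagonal_zero, Finset.sum_singleton, pow_zero, Nat.choose_self, one_smul,
      conv_one_apply, Bialgebra.counit_mul, map_mul]
  | succ k ih =>
    rw [pow_succ, conv_mul_infChar_apply_mul _ Z _ (fun ij : ℕ × ℕ => k.choose ij.1 • (Z : ConvAlg H) ^ ij.1)
      (fun ij : ℕ × ℕ => (Z : ConvAlg H) ^ ij.2) (fun x y => by
        rw [ih]
        refine Finset.sum_congr rfl fun ij _ => ?_
        rw [← smul_mul_assoc]
        rfl),
      Finset.sum_antidiagonal_choose_succ_nsmul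
        (fun i j => ((Z : ConvAlg H) ^ i) x * ((Z : ConvAlg H) ^ j) y), Finset.sum_add_distrib,
      add_comm]
    congr 1
    · refine Finset.sum_congr rfl fun ij _ => ?_
      rw [← smul_mul_assoc, ← pow_succ]
      rfl
    · refine Finset.sum_congr rfl fun ij hij => ?_
      have h := Finset.HasAntidiagonal.mem_antidiagonal.mp hij
      rw [← Nat.choose_symm_of_eq_add h.symm, smul_mul_assoc, ← pow_succ, ← smul_mul_assoc]
      rfl

theorem IsConnectedGradedHopf.exists_exp [GradedAlgebra 𝒜] (h𝒜 : IsConnectedGradedHopf 𝒜)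
    (Z : infChar H) :
    ∃ g : CharGroup H, ∀ N, EqLT 𝒜 N g.toConvAlg (expSum (Z : ConvAlg H) N) := by
  have hZ := h𝒜.infChar_killsZero Z
  obtain ⟨u, hu⟩ := exists_limit (𝒜 := 𝒜) (expSum (Z : ConvAlg H)) fun N m hm x hx => by
    rw [expSum, expSum, Finset.sum_range_succ, conv_add_apply, conv_smul_apply,
      hZ.pow h𝒜 N m hm x hx, conv_zero_apply, smul_zero, add_zero]
  have h1 : u 1 = 1 := by
    rw [hu 1 0 one_pos 1 SetLike.GradedOne.one_mem, expSum, Finset.sum_range_one, pow_zero,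
      conv_smul_apply, conv_one_apply, Bialgebra.counit_one, (algebraMap ℂ Laurent).map_one]
    simp
  have hmul : ∀ m n, ∀ x ∈ 𝒜 m, ∀ y ∈ 𝒜 n, u (x * y) = u x * u y := by
    intro m n x hx y hy
    have hvx : ∀ k, m < k → ((Z : ConvAlg H) ^ k) x = 0 := fun k hk => hZ.pow h𝒜 k m hk x hx
    have hvy : ∀ k, n < k → ((Z : ConvAlg H) ^ k) y = 0 := fun k hk => hZ.pow h𝒜 k n hk y hy
    set N := m + n + 1 with hN
    rw [hu N (m + n) (by omega) _ (SetLike.mul_mem_graded hx hy), hu N m (by omega) x hx,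
      hu N n (by omega) y hy]
    simp only [expSum, conv_sum_apply, conv_smul_apply]
    set α : ℕ → Laurent := fun k => ((k.factorial : ℂ)⁻¹) • ((Z : ConvAlg H) ^ k) x with hα
    set β : ℕ → Laurent := fun k => ((k.factorial : ℂ)⁻¹) • ((Z : ConvAlg H) ^ k) y with hβ
    have e1 : ∀ k, ((k.factorial : ℂ)⁻¹) • ((Z : ConvAlg H) ^ k) (x * y) =
        ∑ i ∈ Finset.range (k + 1), α i * β (k - i) := by
      intro k
      rw [infChar_pow_apply_mul, Finset.smul_sum,
        ← Finset.Nat.sum_antidiagonal_eq_sum_range_succ (fun i j => α i * β j)]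
      refine Finset.sum_congr rfl fun ij hij => ?_
      obtain rfl := Finset.HasAntidiagonal.mem_antidiagonal.mp hij
      rw [hα, hβ]
      simp only [smul_mul_smul_comm]
      rw [← Nat.cast_smul_eq_nsmul ℂ, smul_smul]
      congr 1
      have h2 : ∀ k : ℕ, (k.factorial : ℂ) ≠ 0 := fun k => by exact_mod_cast k.factorial_ne_zero
      have h3 : ((ij.1 + ij.2).choose ij.1 : ℂ) * (ij.1.factorial * ij.2.factorial) =
          (ij.1 + ij.2).factorial := by
        have := Nat.add_choose_mul_factorial_mul_factorial ij.1 ij.2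
        rw [mul_assoc, ← Nat.choose_symm_add] at this
        exact_mod_cast this
      have := h2 ij.1
      have := h2 ij.2
      have := h2 (ij.1 + ij.2)
      rw [← h3] at this ⊢
      have := left_ne_zero_of_mul this
      field_simp
    simp only [e1]
    rw [Finset.sum_range_diag_flip N (fun i j => α i * β j), Finset.sum_mul_sum]
    refine Finset.sum_congr rfl fun i _ => ?_
    refine Finset.sum_subset (Finset.range_mono (Nat.sub_le N i)) fun j hj hj' => ?_
    rw [Finset.mem_range] at hj hj'
    by_cases hi : m < i
    · simp only [hα, hvx i hi, smul_zero, zero_mul]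
    · simp only [hβ, hvy j (by omega), smul_zero, mul_zero]
  exact ⟨charOfConv u h1 (conv_map_mul_of_homogeneous hmul), hu⟩

theorem isExp_of_eqLT [GradedAlgebra 𝒜] {Z : infChar H} {g : CharGroup H}
    (h : ∀ N, EqLT 𝒜 N g.toConvAlg (expSum (Z : ConvAlg H) N)) : IsExp Z g := by
  have e : ∀ (N : ℕ) (x : H), expSum (Z : ConvAlg H) N x =
      ∑ k ∈ Finset.range N, ((k.factorial : ℂ)⁻¹) • (((Z : ConvAlg H) ^ k) x) :=
    fun N x => by rw [expSum, conv_sum_apply]; rfl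
  intro x
  simp only [← e]
  refine induction_homogeneous (𝒜 := 𝒜)
    (P := fun x => ∀ᶠ N in Filter.atTop, g x = expSum (Z : ConvAlg H) N x) ?_ ?_ ?_ x
  · refine Filter.Eventually.of_forall fun N => ?_
    rw [conv_map_zero]
    exact map_zero g.ofConv
  · intro x y hx hy
    filter_upwards [hx, hy] with N h1 h2
    rw [conv_map_add, ← h1, ← h2]
    exact map_add g.ofConv x y
  · intro n x hx
    filter_upwards [Filter.eventually_gt_atTop n] with N hN
    exact h N n hN x hx

/-- The exponential commutes with whatever its argument commutes with. -/
theorem commute_of_expSum [GradedAlgebra 𝒜] (h𝒜 : IsConnectedGradedHopf 𝒜) {u g w : ConvAlg H}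
    (h : ∀ N, EqLT 𝒜 N g (expSum u N)) (hw : Commute u w) : g * w = w * g := by
  refine conv_ext_homogeneous 𝒜 fun n x hx => ?_
  have hc : Commute (expSum u (n + 1)) w :=
    Commute.sum_left _ _ _ fun k _ => (hw.pow_left k).smul_left _
  rw [(h (n + 1)).mul h𝒜 (EqLT.refl _ w) n (Nat.lt_succ_self n) x hx, hc.eq,
    (EqLT.refl _ w).mul h𝒜 (h (n + 1)) n (Nat.lt_succ_self n) x hx]

/-! ### Paths which depend polynomially on time -/

/-- `p` is a polynomial path in `𝓐`, with time derivative `p'`. -/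
def HasPolyDeriv (p p' : ℝ → Laurent) : Prop :=
  ∃ q : Polynomial Laurent, (∀ t : ℝ, p t = q.eval (algebraMap ℂ Laurent t)) ∧
    ∀ t : ℝ, p' t = q.derivative.eval (algebraMap ℂ Laurent t)

theorem HasPolyDeriv.const (a : Laurent) : HasPolyDeriv (fun _ => a) (fun _ => 0) :=
  ⟨Polynomial.C a, fun t => by simp, fun t => by simp⟩

theorem HasPolyDeriv.add {p p' r r' : ℝ → Laurent} (hp : HasPolyDeriv p p')
    (hr : HasPolyDeriv r r') : HasPolyDeriv (fun t => p t + r t) (fun t => p' t + r' t) := by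
  obtain ⟨q, hq, hq'⟩ := hp
  obtain ⟨s, hs, hs'⟩ := hr
  exact ⟨q + s, fun t => by beta_reduce; rw [hq, hs, Polynomial.eval_add],
    fun t => by beta_reduce; rw [hq', hs', Polynomial.derivative_add, Polynomial.eval_add]⟩

theorem HasPolyDeriv.mul {p p' r r' : ℝ → Laurent} (hp : HasPolyDeriv p p')
    (hr : HasPolyDeriv r r') :
    HasPolyDeriv (fun t => p t * r t) (fun t => p' t * r t + p t * r' t) := by
  obtain ⟨q, hq, hq'⟩ := hp
  obtain ⟨s, hs, hs'⟩ := hr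
  exact ⟨q * s, fun t => by beta_reduce; rw [hq, hs, Polynomial.eval_mul],
    fun t => by beta_reduce; rw [hq', hs', hq, hs, Polynomial.derivative_mul, Polynomial.eval_add,
      Polynomial.eval_mul, Polynomial.eval_mul]⟩

theorem HasPolyDeriv.const_smul (c : ℂ) {p p' : ℝ → Laurent} (hp : HasPolyDeriv p p') :
    HasPolyDeriv (fun t => c • p t) (fun t => c • p' t) := by
  have h := (HasPolyDeriv.const (algebraMap ℂ Laurent c)).mul hp
  simpa only [Algebra.smul_def, zero_mul, zero_add] using h

theorem HasPolyDeriv.sum {ι : Type*} (s : Finset ι) {p p' : ι → ℝ → Laurent}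
    (h : ∀ i ∈ s, HasPolyDeriv (p i) (p' i)) :
    HasPolyDeriv (fun t => ∑ i ∈ s, p i t) (fun t => ∑ i ∈ s, p' i t) := by
  classical
  induction s using Finset.induction_on with
  | empty => simpa using HasPolyDeriv.const 0
  | insert i s hi ih =>
    simp only [Finset.sum_insert hi]
    exact (h i (Finset.mem_insert_self i s)).add
      (ih fun j hj => h j (Finset.mem_insert_of_mem hj))

theorem HasPolyDeriv.pow_smul (k : ℕ) (a : Laurent) :
    HasPolyDeriv (fun t => (t : ℂ) ^ k • a) (fun t => ((k : ℂ) * (t : ℂ) ^ (k - 1)) • a) := by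
  refine ⟨Polynomial.monomial k a, fun t => ?_, fun t => ?_⟩
  · beta_reduce
    rw [Polynomial.eval_monomial, Algebra.smul_def, map_pow, mul_comm]
  · beta_reduce
    rw [Polynomial.derivative_monomial, Polynomial.eval_monomial, Algebra.smul_def, map_mul,
      map_pow, map_natCast]
    ring

theorem eval_algebraMap_monomial (k : ℕ) (a : Laurent) (t : ℂ) :
    (Polynomial.monomial k a).eval (algebraMap ℂ Laurent t) = t ^ k • a := by
  rw [Polynomial.eval_monomial, Algebra.smul_def, map_pow, mul_comm]

theorem HasPolyDeriv.polePart {p p' : ℝ → Laurent} (hp : HasPolyDeriv p p') :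
    ∃ r', HasPolyDeriv (fun t => polePart (p t)) r' := by
  obtain ⟨q, hq, -⟩ := hp
  suffices h : ∃ s : Polynomial Laurent, ∀ t : ℝ,
      HopfLax.polePart (q.eval (algebraMap ℂ Laurent t)) = s.eval (algebraMap ℂ Laurent t) by
    obtain ⟨s, hs⟩ := h
    exact ⟨_, s, fun t => by beta_reduce; rw [hq, hs], fun t => rfl⟩
  clear hq
  induction q using Polynomial.induction_on' with
  | add a b ha hb =>
    obtain ⟨s, hs⟩ := ha
    obtain ⟨r, hr⟩ := hb
    exact ⟨s + r, fun t => by rw [Polynomial.eval_add, map_add, hs, hr, Polynomial.eval_add]⟩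
  | monomial k a =>
    exact ⟨Polynomial.monomial k (HopfLax.polePart a), fun t => by
      rw [eval_algebraMap_monomial, map_smul, eval_algebraMap_monomial]⟩

theorem HasPolyDeriv.hasDerivAt_coeff {p p' : ℝ → Laurent} (hp : HasPolyDeriv p p') (n : ℤ)
    (t : ℝ) : HasDerivAt (fun s => (p s).coeff n) ((p' t).coeff n) t := by
  obtain ⟨q, hq, hq'⟩ := hp
  simp only [hq, hq']
  clear hq hq'
  induction q using Polynomial.induction_on' with
  | add a b ha hb =>
    simp only [Polynomial.eval_add, Polynomial.derivative_add, Laurent.coeff_add]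
    exact ha.add hb
  | monomial k a =>
    simp only [Polynomial.derivative_monomial, eval_algebraMap_monomial, Laurent.coeff_smul]
    have h := ((Complex.ofRealCLM.hasDerivAt (x := t)).pow k).mul_const (a.coeff n)
    refine h.congr_deriv ?_
    have e : a * (k : Laurent) = (k : ℂ) • a := by
      rw [Algebra.smul_def, map_natCast, mul_comm]
    rw [e, Laurent.coeff_smul]
    simp only [Complex.ofRealCLM_apply, Complex.ofReal_one, mul_one]
    ring

theorem HasPolyDeriv.unique {p p' p'' : ℝ → Laurent} (h : HasPolyDeriv p p')
    (h' : HasPolyDeriv p p'') : p' = p'' :=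
  funext fun t => Laurent.ext fun n =>
    (h.hasDerivAt_coeff n t).unique (h'.hasDerivAt_coeff n t)

theorem HasPolyDeriv.coeff_eq_zero {p p' : ℝ → Laurent} (h : HasPolyDeriv p p') {n : ℤ}
    (h0 : ∀ t, (p t).coeff n = 0) (t : ℝ) : (p' t).coeff n = 0 := by
  have h1 := h.hasDerivAt_coeff n t
  simp only [h0] at h1
  exact h1.unique (hasDerivAt_const t 0)

/-- `u` is a path in the convolution algebra with polynomial values and time derivative `u'`. -/
def HasConvDeriv (u u' : ℝ → ConvAlg H) : Prop :=
  ∀ x, HasPolyDeriv (fun t => u t x) (fun t => u' t x)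

theorem HasConvDeriv.const (u : ConvAlg H) : HasConvDeriv (fun _ => u) (fun _ => 0) :=
  fun x => HasPolyDeriv.const (u x)

theorem HasConvDeriv.mul {u u' v v' : ℝ → ConvAlg H} (hu : HasConvDeriv u u')
    (hv : HasConvDeriv v v') :
    HasConvDeriv (fun t => u t * v t) (fun t => u' t * v t + u t * v' t) := by
  intro x
  simp only [conv_add_apply, (Coalgebra.Repr.arbitrary ℂ x).convMul_apply,
    ← Finset.sum_add_distrib]
  exact HasPolyDeriv.sum _ fun i _ => (hu _).mul (hv _)

theorem HasConvDeriv.mul_const {u u' : ℝ → ConvAlg H} (hu : HasConvDeriv u u') (v : ConvAlg H) :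
    HasConvDeriv (fun t => u t * v) (fun t => u' t * v) := by
  simpa only [mul_zero, add_zero] using hu.mul (HasConvDeriv.const v)

theorem HasConvDeriv.const_mul {u u' : ℝ → ConvAlg H} (hu : HasConvDeriv u u') (v : ConvAlg H) :
    HasConvDeriv (fun t => v * u t) (fun t => v * u' t) := by
  simpa only [zero_mul, zero_add] using (HasConvDeriv.const v).mul hu

theorem HasConvDeriv.unique {u u' u'' : ℝ → ConvAlg H} (h : HasConvDeriv u u')
    (h' : HasConvDeriv u u'') : u' = u'' :=
  funext fun t => conv_ext fun x => congrFun ((h x).unique (h' x)) t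

theorem exists_hasConvDeriv {u : ℝ → ConvAlg H}
    (h : ∀ x, ∃ p', HasPolyDeriv (fun t => u t x) p') : ∃ u', HasConvDeriv u u' := by
  choose p' hp' using h
  refine ⟨fun t => WithConv.toConv
    { toFun := fun x => p' x t
      map_add' := fun x y => ?_
      map_smul' := fun c x => ?_ }, hp'⟩
  · have h := (hp' x).add (hp' y)
    simp only [← conv_map_add] at h
    exact congrFun ((hp' (x + y)).unique h) t
  · have h := (hp' x).const_smul c
    simp only [← conv_map_smul] at h
    exact congrFun ((hp' (c • x)).unique h) t

theorem exists_hasConvDeriv_of_homogeneous [GradedAlgebra 𝒜] {u : ℝ → ConvAlg H}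
    (h : ∀ n, ∀ x ∈ 𝒜 n, ∃ p', HasPolyDeriv (fun t => u t x) p') : ∃ u', HasConvDeriv u u' := by
  refine exists_hasConvDeriv fun x => induction_homogeneous (𝒜 := 𝒜)
    (P := fun x => ∃ p', HasPolyDeriv (fun t => u t x) p') ?_ ?_ h x
  · simp only [conv_map_zero]
    exact ⟨_, HasPolyDeriv.const 0⟩
  · rintro x y ⟨p, hp⟩ ⟨r, hr⟩
    simp only [conv_map_add]
    exact ⟨_, hp.add hr⟩

variable (𝒜) in
theorem hasConvDeriv_of_homogeneous [GradedAlgebra 𝒜] {u u' : ℝ → ConvAlg H}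
    (h : ∀ n, ∀ x ∈ 𝒜 n, HasPolyDeriv (fun t => u t x) (fun t => u' t x)) :
    HasConvDeriv u u' := by
  refine fun x => induction_homogeneous (𝒜 := 𝒜)
    (P := fun x => HasPolyDeriv (fun t => u t x) (fun t => u' t x)) ?_ ?_ h x
  · simp only [conv_map_zero]
    exact HasPolyDeriv.const 0
  · intro x y hp hr
    simp only [conv_map_add]
    exact hp.add hr

theorem hasConvDeriv_exp [GradedAlgebra 𝒜] (h𝒜 : IsConnectedGradedHopf 𝒜) (Z : infChar H)
    {g : ℝ → ConvAlg H}
    (hg : ∀ t N, EqLT 𝒜 N (g t) (expSum ((t : ℂ) • (Z : ConvAlg H)) N)) :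
    HasConvDeriv g (fun t => (Z : ConvAlg H) * g t) := by
  have hsum : ∀ (t : ℝ) N, expSum ((t : ℂ) • (Z : ConvAlg H)) N =
      ∑ k ∈ Finset.range N, ((k.factorial : ℂ)⁻¹) • (t : ℂ) ^ k • (Z : ConvAlg H) ^ k := by
    intro t N
    simp only [expSum, smul_pow]
  refine hasConvDeriv_of_homogeneous 𝒜 fun n x hx => ?_
  have e1 : (fun t => g t x) = fun t : ℝ => ∑ k ∈ Finset.range (n + 2),
      ((k.factorial : ℂ)⁻¹) • (t : ℂ) ^ k • ((Z : ConvAlg H) ^ k) x := by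
    funext t
    rw [hg t (n + 2) n (by omega) x hx, hsum, conv_sum_apply]
    rfl
  have e2 : (fun t => ((Z : ConvAlg H) * g t) x) = fun t : ℝ => ∑ k ∈ Finset.range (n + 2),
      ((k.factorial : ℂ)⁻¹) • ((k : ℂ) * (t : ℂ) ^ (k - 1)) • ((Z : ConvAlg H) ^ k) x := by
    funext t
    rw [(EqLT.refl (n + 1) (Z : ConvAlg H)).mul h𝒜 (hg t (n + 1)) n (by omega) x hx, hsum,
      Finset.mul_sum, conv_sum_apply, Finset.sum_range_succ' _ (n + 1)]
    simp only [Nat.cast_zero, zero_mul, zero_smul, smul_zero, add_zero]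
    refine Finset.sum_congr rfl fun k _ => ?_
    rw [mul_smul_comm, mul_smul_comm, ← pow_succ', conv_smul_apply, conv_smul_apply, smul_smul,
      smul_smul, Nat.add_sub_cancel, Nat.factorial_succ]
    congr 1
    have h2 : (k.factorial : ℂ) ≠ 0 := by exact_mod_cast k.factorial_ne_zero
    have h3 : (k : ℂ) + 1 ≠ 0 := by exact_mod_cast k.succ_ne_zero
    push_cast
    field_simp
  rw [e1, e2]
  exact HasPolyDeriv.sum _ fun k _ => (HasPolyDeriv.pow_smul k _).const_smul _

theorem expSum_zero (N : ℕ) : expSum (0 : ConvAlg H) (N + 1) = 1 := by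
  rw [expSum, Finset.sum_range_succ', Finset.sum_eq_zero fun k _ => ?_]
  · simp
  · rw [zero_pow k.succ_ne_zero, smul_zero]

theorem eq_one_of_expSum_zero [GradedAlgebra 𝒜] {g : CharGroup H}
    (h : ∀ N, EqLT 𝒜 N g.toConvAlg (expSum 0 N)) : g = 1 := by
  refine CharGroup.toConvAlg_injective (conv_ext_homogeneous 𝒜 fun n x hx => ?_)
  have h2 := h (n + 1) n (Nat.lt_succ_self n) x hx
  rwa [expSum_zero, ← CharGroup.toConvAlg_one] at h2

/-- An `Ad`-covariant map sends `L` to an element commuting with `L`. -/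
theorem IsAdCovariant.commute [GradedAlgebra 𝒜] (h𝒜 : IsConnectedGradedHopf 𝒜)
    {f : infChar H → infChar H} (hf : IsAdCovariant f) (L : infChar H) :
    Commute (L : ConvAlg H) (f L : ConvAlg H) := by
  choose e he using fun t : ℝ => h𝒜.exists_exp ((t : ℂ) • L)
  have hd := hasConvDeriv_exp h𝒜 L he
  have hc : ∀ t, (e t).toConvAlg * (f L : ConvAlg H) = (f L : ConvAlg H) * (e t).toConvAlg := by
    intro t
    rw [← Ad_eq_self_iff, hf, Ad_eq_self_iff.mpr]
    exact commute_of_expSum h𝒜 (he t) ((Commute.refl (L : ConvAlg H)).smul_left _)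
  have h0 : (e 0).toConvAlg = 1 := by
    have h1 := he 0
    rw [Complex.ofReal_zero, zero_smul, ZeroMemClass.coe_zero] at h1
    rw [eq_one_of_expSum_zero h1, CharGroup.toConvAlg_one]
  have h1 := hd.mul_const (f L : ConvAlg H)
  simp only [hc] at h1
  have h2 := congrFun (h1.unique (hd.const_mul (f L : ConvAlg H))) 0
  simp only [h0, mul_one] at h2
  exact h2

/-! ### Local characters -/

theorem IsBirkhoff.mem_orderGE {φ φm φp : CharGroup H} (h : IsBirkhoff φ φm φp) (x : H) :
    φp.toConvAlg x ∈ orderGE 0 := h.holomorphic x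

theorem scale_toConvAlg_apply [GradedAlgebra 𝒜] (t : ℂ) (φ : CharGroup H) {n : ℕ} {x : H}
    (hx : x ∈ 𝒜 n) : (scale 𝒜 t φ).toConvAlg x = expLam (t * n) * φ.toConvAlg x :=
  scale_apply 𝒜 t φ hx

theorem scale_zero [GradedAlgebra 𝒜] (φ : CharGroup H) : scale 𝒜 0 φ = φ := by
  refine CharGroup.toConvAlg_injective (conv_ext_homogeneous 𝒜 fun n x hx => ?_)
  rw [scale_toConvAlg_apply _ _ hx, zero_mul, expLam_zero, one_mul]

theorem conv_scaled_mul [GradedAlgebra 𝒜] (h𝒜 : IsConnectedGradedHopf 𝒜) (t : ℂ)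
    {u v u' v' : ConvAlg H} (hu : ∀ n, ∀ x ∈ 𝒜 n, u' x = expLam (t * n) * u x)
    (hv : ∀ n, ∀ x ∈ 𝒜 n, v' x = expLam (t * n) * v x) {n : ℕ} {x : H} (hx : x ∈ 𝒜 n) :
    (u' * v') x = expLam (t * n) * (u * v) x := by
  obtain ⟨k, r, p, q, hr⟩ := h𝒜.exists_repr hx
  rw [r.convMul_apply, r.convMul_apply, Finset.mul_sum]
  refine Finset.sum_congr rfl fun i _ => ?_
  rw [hu _ _ (hr i).2.1, hv _ _ (hr i).2.2, ← (hr i).1, Nat.cast_add, mul_add, expLam_add]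
  ring

theorem scale_mul [GradedAlgebra 𝒜] (h𝒜 : IsConnectedGradedHopf 𝒜) (t : ℂ) (φ ψ : CharGroup H) :
    scale 𝒜 t (φ * ψ) = scale 𝒜 t φ * scale 𝒜 t ψ := by
  refine CharGroup.toConvAlg_injective (conv_ext_homogeneous 𝒜 fun n x hx => ?_)
  rw [scale_toConvAlg_apply _ _ hx, CharGroup.toConvAlg_mul, CharGroup.toConvAlg_mul,
    conv_scaled_mul h𝒜 t (fun n x hx => scale_toConvAlg_apply t φ hx)
      (fun n x hx => scale_toConvAlg_apply t ψ hx) hx]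

theorem scale_inv [GradedAlgebra 𝒜] (h𝒜 : IsConnectedGradedHopf 𝒜) (t : ℂ) (φ : CharGroup H) :
    scale 𝒜 t φ⁻¹ = (scale 𝒜 t φ)⁻¹ := by
  have h : ∀ ψ χ : CharGroup H, scale 𝒜 t (ψ * χ) = scale 𝒜 t ψ * scale 𝒜 t χ := scale_mul h𝒜 t
  exact map_inv (MonoidHom.mk' (scale 𝒜 t) h) φ

theorem Rtilde_scale_apply [GradedAlgebra 𝒜] (h𝒜 : IsConnectedGradedHopf 𝒜) (t : ℂ)
    (φ : CharGroup H) {n : ℕ} {x : H} (hx : x ∈ 𝒜 n) :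
    (Rtilde 𝒜 (scale 𝒜 t φ) : ConvAlg H) x = expLam (t * n) * (Rtilde 𝒜 φ : ConvAlg H) x := by
  change (((scale 𝒜 t φ)⁻¹).toConvAlg * compY 𝒜 (scale 𝒜 t φ).toConvAlg) x =
    _ * ((φ⁻¹).toConvAlg * compY 𝒜 φ.toConvAlg) x
  rw [← scale_inv h𝒜]
  refine conv_scaled_mul h𝒜 t (fun n x hx => scale_toConvAlg_apply t _ hx) (fun n x hx => ?_) hx
  rw [compY_apply _ hx, compY_apply _ hx, scale_toConvAlg_apply t _ hx, mul_smul_comm]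

theorem lamRtilde_apply [GradedAlgebra 𝒜] (φ : CharGroup H) (x : H) :
    (lamRtilde 𝒜 φ : ConvAlg H) x = lam * (Rtilde 𝒜 φ : ConvAlg H) x := rfl

theorem lamRtilde_scale_mem [GradedAlgebra 𝒜] (h𝒜 : IsConnectedGradedHopf 𝒜) (t : ℂ)
    {φ : CharGroup H} (h : ∀ x, (lamRtilde 𝒜 φ : ConvAlg H) x ∈ orderGE 0) (x : H) :
    (lamRtilde 𝒜 (scale 𝒜 t φ) : ConvAlg H) x ∈ orderGE 0 := by
  refine conv_mem_of_homogeneous 𝒜 _ (fun n x hx => ?_) x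
  rw [lamRtilde_apply, Rtilde_scale_apply h𝒜 t φ hx, mul_left_comm]
  exact mul_mem_orderGE_zero (expLam_mem _) (h x)

theorem hasDerivAt_inv_mul_scale [GradedAlgebra 𝒜] (h𝒜 : IsConnectedGradedHopf 𝒜)
    (φ : CharGroup H) (t : ℂ) (x : H) (m : ℤ) :
    HasDerivAt (fun s : ℂ => ((φ⁻¹ * scale 𝒜 s φ).toConvAlg x).coeff m)
      ((((φ⁻¹ * scale 𝒜 t φ).toConvAlg * (lamRtilde 𝒜 (scale 𝒜 t φ) : ConvAlg H)) x).coeff m)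
      t := by
  have e : (φ⁻¹ * scale 𝒜 t φ).toConvAlg * (lamRtilde 𝒜 (scale 𝒜 t φ) : ConvAlg H) =
      (φ⁻¹).toConvAlg *
        WithConv.toConv (LinearMap.mulLeft ℂ lam ∘ₗ (compY 𝒜 (scale 𝒜 t φ).toConvAlg).ofConv) := by
    rw [CharGroup.toConvAlg_mul, mul_assoc]
    congr 1
    refine conv_ext fun y => ?_
    rw [← char_mul_Rtilde]
    change _ = lam * ((scale 𝒜 t φ).toConvAlg * (Rtilde 𝒜 (scale 𝒜 t φ) : ConvAlg H)) y
    rw [(Coalgebra.Repr.arbitrary ℂ y).convMul_apply, (Coalgebra.Repr.arbitrary ℂ y).convMul_apply,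
      Finset.mul_sum]
    refine Finset.sum_congr rfl fun i _ => ?_
    rw [lamRtilde_apply]
    ring
  rw [e]
  refine induction_homogeneous (𝒜 := 𝒜) (P := fun x => HasDerivAt
    (fun s : ℂ => ((φ⁻¹ * scale 𝒜 s φ).toConvAlg x).coeff m) (Laurent.coeff (((φ⁻¹).toConvAlg *
      (WithConv.toConv (LinearMap.mulLeft ℂ lam ∘ₗ (compY 𝒜 (scale 𝒜 t φ).toConvAlg).ofConv) :
        ConvAlg H)) x) m) t) ?_ ?_ (fun n x hx => ?_) x
  · simp only [conv_map_zero, Laurent.coeff_zero]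
    exact hasDerivAt_const t 0
  · intro x y hx hy
    simp only [conv_map_add, Laurent.coeff_add]
    exact hx.add hy
  · obtain ⟨k, r, p, q, hr⟩ := h𝒜.exists_repr hx
    simp only [CharGroup.toConvAlg_mul, r.convMul_apply, Laurent.coeff_sum]
    refine HasDerivAt.fun_sum fun i _ => ?_
    have h := hasDerivAt_expLam_mul_coeff (q i) t
      (φ.toConvAlg (r.right i) * (φ⁻¹).toConvAlg (r.left i)) m
    refine HasDerivAt.congr_of_eventuallyEq (h.congr_deriv ?_)
      (Filter.Eventually.of_forall fun s => ?_)
    rotate_left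
    · change Laurent.coeff _ m = Laurent.coeff _ m
      rw [scale_toConvAlg_apply _ _ (hr i).2.2]
      congr 1
      ring
    · change _ = Laurent.coeff (_ * (lam * compY 𝒜 (scale 𝒜 t φ).toConvAlg (r.right i))) m
      rw [compY_apply _ (hr i).2.2, scale_toConvAlg_apply _ _ (hr i).2.2, mul_smul_comm,
        mul_smul_comm]
      congr 2
      ring

/-- A character is local exactly when `λR̃(φ)` has no poles. -/
theorem isLocal_iff [GradedAlgebra 𝒜] (h𝒜 : IsConnectedGradedHopf 𝒜) (φ : CharGroup H) :
    IsLocal 𝒜 φ ↔ ∀ x, (lamRtilde 𝒜 φ : ConvAlg H) x ∈ orderGE 0 := by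
  constructor
  · rintro ⟨φm, h⟩ x m hm
    choose φp hφp using h
    have e : ∀ s : ℂ, φ⁻¹ * scale 𝒜 s φ = (φp 0)⁻¹ * φp s := fun s => by
      have h0 := (hφp 0).eq
      rw [scale_zero] at h0
      rw [(hφp s).eq, h0, mul_inv_rev, inv_inv, mul_assoc, mul_inv_cancel_left]
    have h1 := hasDerivAt_inv_mul_scale h𝒜 φ 0 x m
    rw [scale_zero, inv_mul_cancel, CharGroup.toConvAlg_one, one_mul] at h1
    have h2 : (fun s : ℂ => ((φ⁻¹ * scale 𝒜 s φ).toConvAlg x).coeff m) = fun _ => 0 := by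
      funext s
      rw [e s, CharGroup.toConvAlg_mul]
      exact conv_mul_mem_orderGE (CharGroup.inv_mem (hφp 0).mem_orderGE)
        (hφp s).mem_orderGE x m hm
    rw [h2] at h1
    exact h1.unique (hasDerivAt_const 0 0)
  · intro h
    have hol : ∀ n, ∀ x ∈ 𝒜 n, ∀ t, (φ⁻¹ * scale 𝒜 t φ).toConvAlg x ∈ orderGE 0 := by
      intro n
      induction n using Nat.strong_induction_on with
      | _ n ih =>
        intro x hx t m hm
        have hd : ∀ s, HasDerivAt (fun s : ℂ => ((φ⁻¹ * scale 𝒜 s φ).toConvAlg x).coeff m) 0 s := by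
          intro s
          have h1 := hasDerivAt_inv_mul_scale h𝒜 φ s x m
          have h2 := h𝒜.conv_mem (orderGE 0) (u := (φ⁻¹ * scale 𝒜 s φ).toConvAlg)
            (v := lamRtilde 𝒜 (scale 𝒜 s φ)) hx (fun p q hpq a ha b hb => by
              rcases Nat.eq_zero_or_pos q with rfl | hq
              · rw [h𝒜.infChar_killsZero _ b hb, mul_zero]
                exact Submodule.zero_mem _
              · exact mul_mem_orderGE_zero (ih p (by omega) a ha s)
                  (lamRtilde_scale_mem h𝒜 s h b)) m hm
          rwa [h2] at h1
        have h3 := is_const_of_deriv_eq_zero (fun s => (hd s).differentiableAt)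
          (fun s => (hd s).deriv) t 0
        rw [h3, scale_zero, inv_mul_cancel]
        exact conv_one_mem_orderGE x m hm
    obtain ⟨φm, φp, hb⟩ := h𝒜.exists_isBirkhoff φ
    refine ⟨φm, fun t => ⟨φp * (φ⁻¹ * scale 𝒜 t φ), ?_, hb.polar, fun x => ?_⟩⟩
    · rw [← mul_assoc, ← mul_assoc, ← hb.eq, mul_inv_cancel, one_mul]
    · exact conv_mul_mem_orderGE hb.mem_orderGE
        (conv_mem_of_homogeneous 𝒜 _ fun n y hy => hol n y hy t) x

/-! ### The Lax flow preserves the pole order -/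

theorem bracket_half_projDiff {L F : infChar H} (h : Commute (L : ConvAlg H) (F : ConvAlg H)) :
    (bracket L ((1 / 2 : ℂ) • projDiff F) : ConvAlg H) =
      (poleInf F : ConvAlg H) * L - (L : ConvAlg H) * poleInf F := by
  have e : (((1 / 2 : ℂ) • projDiff F : infChar H) : ConvAlg H) =
      (1 / 2 : ℂ) • (F : ConvAlg H) - poleInf F := by
    refine conv_ext fun x => ?_
    change (1 / 2 : ℂ) • (projDiff F : ConvAlg H) x =
      (1 / 2 : ℂ) • (F : ConvAlg H) x - (poleInf F : ConvAlg H) x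
    rw [poleInf_apply, projDiff_apply, holPart_apply, sub_sub, ← two_smul ℂ, smul_sub, smul_smul]
    norm_num
  rw [bracket_coe, e, mul_sub, sub_mul, mul_smul_comm, smul_mul_assoc, h.eq]
  abel

theorem IsLaxSolution.mem_orderGE [GradedAlgebra 𝒜] (h𝒜 : IsConnectedGradedHopf 𝒜)
    {f : infChar H → infChar H} (hf : IsAdCovariant f) {L₀ : infChar H} {L : ℝ → infChar H}
    (hL : IsLaxSolution f L₀ L) {k : ℤ} (h0 : ∀ x, (L₀ : ConvAlg H) x ∈ orderGE k) (t : ℝ) (x : H) :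
    (L t : ConvAlg H) x ∈ orderGE k := by
  have key : ∀ n, ∀ x ∈ 𝒜 n, ∀ t, (L t : ConvAlg H) x ∈ orderGE k := by
    intro n
    induction n using Nat.strong_induction_on with
    | _ n ih =>
      intro x hx t m hm
      have hd : ∀ s, HasDerivAt (fun s : ℝ => ((L s : ConvAlg H) x).coeff m) 0 s := by
        intro s
        have h1 := hL.deriv s x m
        set F := f (L s) with hF
        have hc : Commute (L s : ConvAlg H) (F : ConvAlg H) := hf.commute h𝒜 (L s)
        set G : infChar H := F - poleInf F with hG
        have hGhol : ∀ y, (G : ConvAlg H) y ∈ orderGE 0 := fun y => by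
          change (F : ConvAlg H) y - (poleInf F : ConvAlg H) y ∈ orderGE 0
          rw [← polePart_eq_zero, map_sub, poleInf_apply, polePart_eq_self (polePart_mem _),
            sub_self]
        have e : (poleInf F : ConvAlg H) * L s - (L s : ConvAlg H) * poleInf F =
            (L s : ConvAlg H) * G - (G : ConvAlg H) * L s := by
          have e1 : (G : ConvAlg H) = (F : ConvAlg H) - (poleInf F : ConvAlg H) := rfl
          rw [e1, mul_sub, sub_mul, hc.eq]
          abel
        rw [bracket_half_projDiff hc, e, conv_sub_apply] at h1
        have h2 : ((L s : ConvAlg H) * G) x - ((G : ConvAlg H) * L s) x ∈ orderGE k := by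
          refine Submodule.sub_mem _ (h𝒜.conv_mem _ hx fun p q hpq a ha b hb => ?_)
            (h𝒜.conv_mem _ hx fun p q hpq a ha b hb => ?_)
          · rcases Nat.eq_zero_or_pos q with rfl | hq
            · rw [h𝒜.infChar_killsZero _ b hb, mul_zero]
              exact Submodule.zero_mem _
            · exact mul_mem_orderGE_zero (ih p (by omega) a ha s) (hGhol b)
          · rcases Nat.eq_zero_or_pos p with rfl | hp
            · rw [h𝒜.infChar_killsZero _ a ha, zero_mul]
              exact Submodule.zero_mem _
            · rw [mul_comm]
              exact mul_mem_orderGE_zero (ih q (by omega) b hb s) (hGhol a)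
        rwa [h2 m hm] at h1
      have h3 := is_const_of_deriv_eq_zero (fun s => (hd s).differentiableAt)
        (fun s => (hd s).deriv) t 0
      rw [h3, hL.init]
      exact h0 x m hm
  exact conv_mem_of_homogeneous 𝒜 _ (fun n y hy => key n y hy t) x

/-! ### The factorization flow -/

/-- The polar Birkhoff factor of a polynomial path is a polynomial path. -/
theorem IsConnectedGradedHopf.exists_hasConvDeriv_birkhoff [GradedAlgebra 𝒜]
    (h𝒜 : IsConnectedGradedHopf 𝒜) {g m p : ℝ → CharGroup H} (hb : ∀ t, IsBirkhoff (g t) (m t) (p t))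
    {g' : ℝ → ConvAlg H} (hg : HasConvDeriv (fun t => (g t).toConvAlg) g') :
    ∃ m', HasConvDeriv (fun t => (m t).toConvAlg) m' := by
  refine exists_hasConvDeriv_of_homogeneous (𝒜 := 𝒜) fun n => ?_
  induction n using Nat.strong_induction_on with
  | _ n ih =>
    intro x hx
    rcases Nat.eq_zero_or_pos n with rfl | hn
    · simp only [h𝒜.char_apply _ hx]
      exact ⟨_, HasPolyDeriv.const _⟩
    have e : ∀ t, (m t).toConvAlg x =
        (-1 : ℂ) • polePart (((m t).toConvAlg * ((g t).toConvAlg - 1)) x) := by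
      intro t
      have h1 : (m t).toConvAlg * ((g t).toConvAlg - 1) = (p t).toConvAlg - (m t).toConvAlg := by
        rw [mul_sub, mul_one, ← CharGroup.toConvAlg_mul, (hb t).eq, mul_inv_cancel_left]
      have h2 := (hb t).sub_one_mem_polar x
      rw [conv_sub_apply, h𝒜.one_apply hn.ne' hx, sub_zero] at h2
      rw [h1, conv_sub_apply, map_sub, polePart_eq_zero.mpr ((hb t).mem_orderGE x),
        polePart_eq_self h2, zero_sub, neg_smul, one_smul, neg_neg]
    simp only [e]
    suffices h : ∃ r', HasPolyDeriv
        (fun t => ((m t).toConvAlg * ((g t).toConvAlg - 1)) x) r' by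
      obtain ⟨r', hr'⟩ := h
      obtain ⟨s', hs'⟩ := hr'.polePart
      exact ⟨_, hs'.const_smul (-1)⟩
    obtain ⟨k, r, a, b, hr⟩ := h𝒜.exists_repr hx
    simp only [r.convMul_apply]
    suffices h : ∀ i, ∃ r', HasPolyDeriv
        (fun t => (m t).toConvAlg (r.left i) * ((g t).toConvAlg - 1) (r.right i)) r' by
      choose r' hr' using h
      exact ⟨_, HasPolyDeriv.sum _ fun i _ => hr' i⟩
    intro i
    rcases Nat.eq_zero_or_pos (b i) with hq | hq
    · simp only [h𝒜.char_sub_one _ _ (hq ▸ (hr i).2.2), mul_zero]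
      exact ⟨_, HasPolyDeriv.const 0⟩
    · obtain ⟨s', hs'⟩ := ih (a i) (by have := (hr i).1; omega) _ (hr i).2.1
      have h1 := (hg (r.right i)).add
        (HasPolyDeriv.const ((-1 : ℂ) • (1 : ConvAlg H) (r.right i)))
      simp only [neg_smul, one_smul, ← sub_eq_add_neg, ← conv_sub_apply] at h1
      exact ⟨_, hs'.mul h1⟩

theorem HasConvDeriv.inv {g : ℝ → CharGroup H} {g' : ℝ → ConvAlg H}
    (hg : HasConvDeriv (fun t => (g t).toConvAlg) g') :
    HasConvDeriv (fun t => ((g t)⁻¹).toConvAlg)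
      (fun t => -(((g t)⁻¹).toConvAlg * g' t * ((g t)⁻¹).toConvAlg)) := by
  obtain ⟨v, hv⟩ : ∃ v, HasConvDeriv (fun t => ((g t)⁻¹).toConvAlg) v :=
    exists_hasConvDeriv fun x => ⟨_, hg (HopfAlgebra.antipode ℂ x)⟩
  have h1 := hg.mul hv
  simp only [CharGroup.mul_inv_conv] at h1
  have h2 := h1.unique (HasConvDeriv.const (1 : ConvAlg H))
  have e : v = fun t => -(((g t)⁻¹).toConvAlg * g' t * ((g t)⁻¹).toConvAlg) := by
    funext t
    have h3 : g' t * ((g t)⁻¹).toConvAlg + (g t).toConvAlg * v t = 0 := congrFun h2 t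
    have h4 : ((g t)⁻¹).toConvAlg * (g' t * ((g t)⁻¹).toConvAlg + (g t).toConvAlg * v t) = 0 := by
      rw [h3, mul_zero]
    rw [mul_add, ← mul_assoc, ← mul_assoc, CharGroup.inv_mul_conv, one_mul] at h4
    exact (neg_eq_of_add_eq_zero_right h4).symm
  rwa [e] at hv

theorem HasConvDeriv.Ad {g : ℝ → CharGroup H} {g' : ℝ → ConvAlg H}
    (hg : HasConvDeriv (fun t => (g t).toConvAlg) g') (L : infChar H) :
    HasConvDeriv (fun t => (HopfLax.Ad (g t) L : ConvAlg H))
      (fun t => g' t * ((g t)⁻¹).toConvAlg * (HopfLax.Ad (g t) L : ConvAlg H) -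
        (HopfLax.Ad (g t) L : ConvAlg H) * (g' t * ((g t)⁻¹).toConvAlg)) := by
  have h := (hg.mul_const (L : ConvAlg H)).mul hg.inv
  have e : (fun t => g' t * (L : ConvAlg H) * ((g t)⁻¹).toConvAlg + (g t).toConvAlg *
        (L : ConvAlg H) * -(((g t)⁻¹).toConvAlg * g' t * ((g t)⁻¹).toConvAlg)) =
      fun t => g' t * ((g t)⁻¹).toConvAlg * (HopfLax.Ad (g t) L : ConvAlg H) -
        (HopfLax.Ad (g t) L : ConvAlg H) * (g' t * ((g t)⁻¹).toConvAlg) := by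
    funext t
    have h1 : g' t * ((g t)⁻¹).toConvAlg * (HopfLax.Ad (g t) L : ConvAlg H) =
        g' t * (L : ConvAlg H) * ((g t)⁻¹).toConvAlg := by
      rw [Ad_coe]
      simp only [← mul_assoc]
      rw [mul_assoc (g' t), CharGroup.inv_mul_conv, mul_one]
    rw [h1, Ad_coe, sub_eq_add_neg, mul_neg]
    simp only [mul_assoc]
  rwa [e] at h

theorem HasConvDeriv.mem_polar {u u' : ℝ → ConvAlg H} (h : HasConvDeriv u u')
    (h0 : ∀ t x, (u t - 1) x ∈ polarSeries) (t : ℝ) (x : H) : u' t x ∈ polarSeries := by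
  intro n hn
  have h1 := (h x).add (HasPolyDeriv.const ((-1 : ℂ) • (1 : ConvAlg H) x))
  simp only [neg_smul, one_smul, ← sub_eq_add_neg, ← conv_sub_apply, add_zero] at h1
  exact h1.coeff_eq_zero (fun s => h0 s x n hn) t

theorem HasConvDeriv.mem_orderGE {u u' : ℝ → ConvAlg H} (h : HasConvDeriv u u') {k : ℤ}
    (h0 : ∀ t x, u t x ∈ orderGE k) (t : ℝ) (x : H) : u' t x ∈ orderGE k :=
  fun n hn => (h x).coeff_eq_zero (fun s => h0 s x n hn) t

/-- The factorization flow solves the Lax equation. -/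
theorem exists_factorizationFlow [GradedAlgebra 𝒜] (h𝒜 : IsConnectedGradedHopf 𝒜)
    {f : infChar H → infChar H} (hf : IsAdCovariant f) (L₀ : infChar H) :
    ∃ L : ℝ → infChar H, IsLaxSolution f L₀ L ∧ IsFactorizationFlow f L₀ L := by
  choose g hg using fun t : ℝ => h𝒜.exists_exp ((-(t : ℂ)) • f L₀)
  choose m p hb using fun t => h𝒜.exists_isBirkhoff (g t)
  have hcomm := hf.commute h𝒜 L₀
  have hgd : HasConvDeriv (fun t => (g t).toConvAlg)
      (fun t => ((-f L₀ : infChar H) : ConvAlg H) * (g t).toConvAlg) := by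
    refine hasConvDeriv_exp h𝒜 (-f L₀) fun t N => ?_
    have e : (t : ℂ) • ((-f L₀ : infChar H) : ConvAlg H) =
        (((-(t : ℂ)) • f L₀ : infChar H) : ConvAlg H) := by
      change (t : ℂ) • -(f L₀ : ConvAlg H) = (-(t : ℂ)) • (f L₀ : ConvAlg H)
      rw [smul_neg, neg_smul]
    rw [e]
    exact hg t N
  have hgL : ∀ t, HopfLax.Ad (g t) L₀ = L₀ := fun t =>
    Ad_eq_self_iff.mpr (commute_of_expSum h𝒜 (hg t) (hcomm.symm.smul_left _))
  have hp : ∀ t, p t = m t * g t := fun t => by rw [(hb t).eq, mul_inv_cancel_left]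
  obtain ⟨m', hm⟩ := h𝒜.exists_hasConvDeriv_birkhoff hb hgd
  have hpd : HasConvDeriv (fun t => (p t).toConvAlg) (fun t => m' t * (g t).toConvAlg +
      (m t).toConvAlg * (((-f L₀ : infChar H) : ConvAlg H) * (g t).toConvAlg)) := by
    have h := hm.mul hgd
    simp only [← CharGroup.toConvAlg_mul, ← hp] at h
    exact h
  set L : ℝ → infChar H := fun t => HopfLax.Ad (m t) L₀ with hL
  have hfL : ∀ t, f (L t) = HopfLax.Ad (m t) (f L₀) := fun t => (hf (m t) L₀).symm
  have hA : ∀ t x, (m' t * ((m t)⁻¹).toConvAlg) x ∈ polarSeries := by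
    intro t x
    rw [(Coalgebra.Repr.arbitrary ℂ x).convMul_apply]
    refine Submodule.sum_mem _ fun i _ => mul_mem_polar_of_sub
      (hm.mem_polar (fun s y => (hb s).sub_one_mem_polar y) t _)
      ((hb t).inv_sub_one_mem_polar _)
  have hB : ∀ t x, (m' t * ((m t)⁻¹).toConvAlg - (f (L t) : ConvAlg H)) x ∈ orderGE 0 := by
    intro t
    have e : m' t * ((m t)⁻¹).toConvAlg - (f (L t) : ConvAlg H) =
        (m' t * (g t).toConvAlg + (m t).toConvAlg *
          (((-f L₀ : infChar H) : ConvAlg H) * (g t).toConvAlg)) * ((p t)⁻¹).toConvAlg := by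
      have e1 : ((-f L₀ : infChar H) : ConvAlg H) = -(f L₀ : ConvAlg H) := rfl
      have e2 : (g t).toConvAlg * ((p t)⁻¹).toConvAlg = ((m t)⁻¹).toConvAlg := by
        rw [← CharGroup.toConvAlg_mul, hp, mul_inv_rev, mul_inv_cancel_left]
      rw [e1, hfL, Ad_coe, add_mul, mul_assoc (m' t), e2, mul_assoc (m t).toConvAlg (_ * _),
        mul_assoc (-(f L₀ : ConvAlg H)), e2, neg_mul, mul_neg, ← sub_eq_add_neg, mul_assoc]
    rw [e]
    exact conv_mul_mem_orderGE (hpd.mem_orderGE (fun s y => (hb s).mem_orderGE y) t)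
      (CharGroup.inv_mem (hb t).mem_orderGE)
  have hpole : ∀ t, (poleInf (f (L t)) : ConvAlg H) = m' t * ((m t)⁻¹).toConvAlg := by
    intro t
    refine conv_ext fun x => ?_
    have h1 := polePart_eq_zero.mpr (hB t x)
    rw [conv_sub_apply, map_sub, polePart_eq_self (hA t x), sub_eq_zero] at h1
    rw [poleInf_apply, h1]
  refine ⟨L, ⟨?_, fun t x n => ?_⟩, fun t => ⟨g t, m t, p t, isExp_of_eqLT (hg t), hb t, rfl, ?_⟩⟩
  · have hg0 : g 0 = 1 := by
      have h1 := hg 0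
      rw [Complex.ofReal_zero, neg_zero, zero_smul, ZeroMemClass.coe_zero] at h1
      exact eq_one_of_expSum_zero h1
    have hm0 : m 0 = 1 := by
      refine CharGroup.toConvAlg_injective (conv_ext fun x => ?_)
      have h1 := (hb 0).sub_one_mem_polar x
      have h2 := (hb 0).mem_orderGE x
      rw [hp, hg0, mul_one] at h2
      have h3 := polePart_eq_zero.mpr (Submodule.sub_mem _ h2 (conv_one_mem_orderGE x))
      rw [← conv_sub_apply, polePart_eq_self h1, conv_sub_apply, sub_eq_zero] at h3
      rw [h3, CharGroup.toConvAlg_one]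
    rw [hL]
    beta_reduce
    rw [hm0, ← hg0, hgL]
  · rw [bracket_half_projDiff (hf.commute h𝒜 (L t)), hpole]
    exact (hm.Ad L₀ x).hasDerivAt_coeff n t
  · rw [hp, Ad_mul, hgL]

end HopfLax

end

open HopfLax in
theorem theorem7p5 {H : Type*} [CommRing H] [HopfAlgebra ℂ H]
    (𝒜 : ℕ → Submodule ℂ H) [GradedAlgebra 𝒜] (h𝒜 : IsConnectedGradedHopf 𝒜)
    (f : infChar H → infChar H) (hf : IsAdCovariant f)
    (φ : CharGroup H) (hφ : IsLocal 𝒜 φ) :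
    (Function.Bijective (Rtilde 𝒜) ∧
      (∃ L : ℝ → infChar H, IsLaxSolution f (Rtilde 𝒜 φ) L ∧
        IsFactorizationFlow f (Rtilde 𝒜 φ) L) ∧
      ∀ L : ℝ → infChar H, IsLaxSolution f (Rtilde 𝒜 φ) L →
        ∀ (t : ℝ) (φt : CharGroup H), Rtilde 𝒜 φt = L t → IsLocal 𝒜 φt) ∧
    (Function.Bijective (lamRtilde 𝒜) ∧
      (∃ L : ℝ → infChar H, IsLaxSolution f (lamRtilde 𝒜 φ) L ∧
        IsFactorizationFlow f (lamRtilde 𝒜 φ) L) ∧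
      ∀ L : ℝ → infChar H, IsLaxSolution f (lamRtilde 𝒜 φ) L →
        ∀ (t : ℝ) (τt : CharGroup H), lamRtilde 𝒜 τt = L t → IsLocal 𝒜 τt) := by
  have h0 := (isLocal_iff h𝒜 φ).mp hφ
  refine ⟨⟨h𝒜.Rtilde_bijective, exists_factorizationFlow h𝒜 hf _, fun L hL t φt ht => ?_⟩,
    h𝒜.lamRtilde_bijective, exists_factorizationFlow h𝒜 hf _, fun L hL t τt ht => ?_⟩
  · refine (isLocal_iff h𝒜 φt).mpr fun x => ?_
    rw [lamRtilde_apply, ht]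
    exact lam_mul_mem_orderGE_zero.mpr
      (hL.mem_orderGE h𝒜 hf (fun y => lam_mul_mem_orderGE_zero.mp (h0 y)) t x)
  · refine (isLocal_iff h𝒜 τt).mpr fun x => ?_
    rw [ht]
    exact hL.mem_orderGE h𝒜 hf h0 t x
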